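/- \textbf{Surface transport theorem.} Let $I\subset\mathbb{R}$ be an interval with more than one point, and let $S_t\subset\mathbb{R}^3$ ($t\in I$) be a smooth evolving surface with velocity field $X$: each $S_t$ is a smooth embedded surface, possibly with boundary, and for some $t_0\in I$ there are diffeomorphisms $\Phi_t:S_{t_0}\to S_t$ with $\Phi_t(x)$ smooth in $(t,x)\in I\times S_{t_0}$, $\Phi_{t_0}=\mathrm{id}$ and $\partial_t\Phi_t(x)=X(\Phi_t(x),t)$. Let $A_t\subset S_t$ be a material patch, that is, each $A_t$ is a Borel set contained in a compact subset of $S_t$, and every trajectory $t\mapsto\gamma(t)\in S_t$ $(t\in I)$ of $\dot\gamma=X(\gamma,t)$ that lies in the patch at one time lies in it at all times (so $A_t=\Phi_t(A_{t_0})$). Let $f(x,t)$ be a real-valued function of class $C^1$ on a neighborhood of $\bigcup_{t\in I}S_t\times\{t\}$ in $\mathbb{R}^3\times I$. Let $\mathcal{H}^2$ be the two-dimensional Hausdorff measure, normalized so as to be surface area, and let $\operatorname{div}_S X=\sum_{i=1}^2 e_i\cdot D_{e_i}X$ for an orthonormal basis $e_1,e_2$ of the tangent plane $T_xS_t$. Then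 for every $t\in I$ the integrals below exist and \[ \frac{d}{dt}\int_{A_t} f\,d\mathcal{H}^2=\int_{A_t}\bigl(\partial_t f+X\cdot\nabla f+f\operatorname{div}_S X\bigr)\,d\mathcal{H}^2 . \] If, in addition, $f$ is insoluble, that is, $\mathbf{n}\cdot\nabla f=0$ on $S_t$ for all $t\in I$, where $\mathbf{n}$ is a unit normal field of $S_t$, then for every $t\in I$ \[ \frac{d}{dt}\int_{A_t} f\,d\mathcal{H}^2=\int_{A_t}\bigl(\partial_t f+X\cdot\nabla_S f+f\operatorname{div}_S X\bigr)\,d\mathcal{H}^2, \] where $\nabla_S f$ is the gradient of $f|_{S_t}$ along $S_t$, a vector in $T_xS_t$. (Time derivatives at end points of $I$ that belong to $I$ are one-sided.) -/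

import Mathlib

open Set MeasureTheory
open scoped ContDiff RealInnerProductSpace

namespace SurfaceTransport

/-- Euclidean three-space. -/
abbrev E3 : Type := EuclideanSpace ℝ (Fin 3)

/-- The Euclidean plane, model space of surfaces. -/
abbrev E2 : Type := EuclideanSpace ℝ (Fin 2)

/-- The closed half-plane, the model of a surface with boundary. -/
def halfPlane : Set E2 := {y | 0 ≤ y 0}

/-- `S` is a smooth embedded surface in `ℝ³`, possibly with boundary: locally, `S` is diffeomorphic
to a relatively open subset `V ∩ halfPlane` of the closed half-plane, the diffeomorphism and its
inverse being restrictions of smooth maps on open subsets of `ℝ²` and `ℝ³`.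
(Near interior points, `V` can be chosen inside the open half-plane.) -/
def IsSmoothSurface (S : Set E3) : Prop :=
  ∀ p ∈ S, ∃ (U : Set E3) (V : Set E2) (φ : E2 → E3) (ψ : E3 → E2),
    IsOpen U ∧ p ∈ U ∧ IsOpen V ∧
    ContDiffOn ℝ ∞ φ V ∧ ContDiffOn ℝ ∞ ψ U ∧
    MapsTo φ (V ∩ halfPlane) (S ∩ U) ∧ MapsTo ψ (S ∩ U) (V ∩ halfPlane) ∧
    LeftInvOn ψ φ (V ∩ halfPlane) ∧ RightInvOn ψ φ (S ∩ U)

/-- The tangent space `T_x S`: the linear span of the tangent cone of `S` at `x`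
(at a boundary point of a surface it is still the full tangent plane). -/
noncomputable def tangentSpace (S : Set E3) (x : E3) : Submodule ℝ E3 :=
  Submodule.span ℝ (tangentConeAt ℝ S x)

/-- `ν` is a unit normal vector of `S` at `x`. -/
def IsUnitNormal (S : Set E3) (x ν : E3) : Prop :=
  ‖ν‖ = 1 ∧ ∀ v ∈ tangentSpace S x, ⟪ν, v⟫ = 0

/-- The surface gradient `∇_S g (x) ∈ T_x S`: the vector of `T_x S` representing the derivative of
`g` along `S`. On `T_x S` the derivative within `S` is unique, and it depends on `g` on `S` only. -/
noncomputable def surfaceGrad (S : Set E3) (g : E3 → ℝ) (x : E3) : E3 :=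
  ((InnerProductSpace.toDual ℝ (tangentSpace S x)).symm
    ((fderivWithin ℝ g S x).comp (tangentSpace S x).subtypeL) : tangentSpace S x)

/-- The surface divergence `div_S Y (x)`: the trace over `T_x S` of
`v ↦ P (D_v Y)`, where `D_v Y` is the derivative of `Y` along `S` in the tangent direction `v` and
`P` is the orthogonal projection onto `T_x S`; that is, `∑ ⟪D_{e_i} Y, e_i⟫` for an orthonormal
basis `e_i` of `T_x S`. The field `Y` need not be tangent to `S`. -/
noncomputable def surfaceDiv (S : Set E3) (Y : E3 → E3) (x : E3) : ℝ :=
  LinearMap.trace ℝ (tangentSpace S x)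
    (((tangentSpace S x).orthogonalProjectionOnto.comp
      ((fderivWithin ℝ Y S x).comp (tangentSpace S x).subtypeL) :
        tangentSpace S x →L[ℝ] tangentSpace S x) : tangentSpace S x →ₗ[ℝ] tangentSpace S x)

/-- `S_t`, `t ∈ I`, is a smooth evolving surface with velocity field `X`: every `S_t` is a smooth
surface, and the points of the surface move with velocity `X` through a flow map
`Φ_t : S_{t₀} → S_t` that is smooth in `(t, x)`, is the identity at the reference time `t₀`, and is
a diffeomorphism for each `t`. Only the values of `X t` on `S t` matter. -/
structure IsSmoothEvolvingSurface (I : Set ℝ) (S : ℝ → Set E3) (X : ℝ → E3 → E3) : Prop where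
  smooth : ∀ t ∈ I, IsSmoothSurface (S t)
  flow : ∃ t₀ ∈ I, ∃ Φ Ψ : ℝ → E3 → E3,
    ContDiffOn ℝ ∞ (fun q : ℝ × E3 => Φ q.1 q.2) (I ×ˢ S t₀) ∧
    (∀ x ∈ S t₀, Φ t₀ x = x) ∧
    (∀ t ∈ I, ContDiffOn ℝ ∞ (Ψ t) (S t) ∧
      MapsTo (Φ t) (S t₀) (S t) ∧ MapsTo (Ψ t) (S t) (S t₀) ∧
      LeftInvOn (Ψ t) (Φ t) (S t₀) ∧ RightInvOn (Ψ t) (Φ t) (S t)) ∧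
    ∀ x ∈ S t₀, IsIntegralCurveOn (fun t => Φ t x) X I

/-- `A_t ⊆ S_t`, `t ∈ I`, is a material patch: each `A_t` is a Borel set contained in a compact
subset of `S_t`, and the patch moves with the flow, i.e. a trajectory of `X` on the surface that
is in the patch at one time is in it at all times. -/
structure IsMaterialPatch (I : Set ℝ) (S : ℝ → Set E3) (X : ℝ → E3 → E3) (A : ℝ → Set E3) :
    Prop where
  measurable : ∀ t ∈ I, MeasurableSet (A t)
  relCompact : ∀ t ∈ I, ∃ K : Set E3, IsCompact K ∧ A t ⊆ K ∧ K ⊆ S t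
  material : ∀ γ : ℝ → E3, (∀ t ∈ I, γ t ∈ S t) → IsIntegralCurveOn γ X I →
    ∀ s ∈ I, ∀ t ∈ I, γ s ∈ A s → γ t ∈ A t

end SurfaceTransport

namespace SurfaceTransport

open Filter Topology
-- Area formula for injective C¹ immersions, up to the boundary of the domain
section AreaFormula

open scoped NNReal ENNReal

/-! The integral is pulled back to a domain that does not move. A chart `φ` of the reference
surface, composed with the flow, gives `G (t, y) = Φ t (φ y)`, for each `t` an injective immersion
onto a relatively open piece of `S t`. By the area formula
(`integral_image_eq_integral_normDet_smul`) the integral of `f` over the part of the patch in that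
piece is `∫ J f(t, G) dy` over a fixed Borel set `B`, where `J` is the root of the Gram determinant
of the space derivative of `G`.

The pulled-back integrand is C¹ up to the edge of the half-plane and the end points of `I`, and `B`
lies in a compact set, so differentiation under the integral sign is legitimate
(`hasDerivWithinAt_setIntegral_of_continuousOn`). The chain rule produces `∂_t f + X · ∇f`. For `J`,
Jacobi's formula gives `∂_t J = J tr M`, where `M` is the tangential part of the time derivative of
`d_y G`, read in the chart. Since mixed second derivatives commute, `∂_t d_y G = d_y (X ∘ G)`, and
`tr M` is the surface divergence of `X` (`IsMovingChart.hasDerivWithinAt_normDet`).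

To globalize, the material property gives `A t = Φ t '' A t₀`. As `A t₀` lies in a compact subset of
the surface, it splits into finitely many disjoint Borel pieces, each inside one chart, and the
formula is additive (`isTransported_image`). In the insoluble case `∇f` is orthogonal to the normal,
hence equal to `∇_S f`. -/

theorem euclideanHausdorffMeasure_image_le_of_lipschitzOnWith {X Y : Type*} [MetricSpace X]
    [MetricSpace Y] [MeasurableSpace X] [BorelSpace X] [MeasurableSpace Y] [BorelSpace Y]
    {K : ℝ≥0} {f : X → Y} {s : Set X} (hf : LipschitzOnWith K f s) (d : ℕ) :
    μHE[d] (f '' s) ≤ (K : ℝ≥0∞) ^ d * μHE[d] s := by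
  have h := hf.hausdorffMeasure_image_le (d := (d : ℝ)) (by positivity)
  rw [ENNReal.rpow_natCast] at h
  simp only [Measure.euclideanHausdorffMeasure_def, Measure.smul_apply, ENNReal.smul_def,
    smul_eq_mul]
  rw [mul_left_comm]
  gcongr

/-- If `f` expands distances at most `K` times more than `g`, so does its image for measures. -/
theorem euclideanHausdorffMeasure_image_le_image {α X Y : Type*} [MetricSpace X]
    [MetricSpace Y] [MeasurableSpace X] [BorelSpace X] [MeasurableSpace Y] [BorelSpace Y]
    {K : ℝ≥0} {f : α → Y} {g : α → X} {s : Set α}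
    (h : ∀ x ∈ s, ∀ y ∈ s, dist (f x) (f y) ≤ K * dist (g x) (g y)) (d : ℕ) :
    μHE[d] (f '' s) ≤ (K : ℝ≥0∞) ^ d * μHE[d] (g '' s) := by
  rcases isEmpty_or_nonempty α with hα | hα
  · simp [s.eq_empty_of_isEmpty]
  -- `f` takes equal values where `g` does, so it factors as `f ∘ k` through a section `k` of `g`,
  -- and the factor is `K`-Lipschitz.
  choose! k hk hgk using fun (y : X) (hy : y ∈ g '' s) => hy
  have hL : LipschitzOnWith K (f ∘ k) (g '' s) := by
    refine LipschitzOnWith.of_dist_le_mul fun x hx y hy => ?_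
    have := h _ (hk x hx) _ (hk y hy)
    rwa [hgk x hx, hgk y hy] at this
  have him : (f ∘ k) '' (g '' s) = f '' s := by
    rw [image_image]
    refine image_congr fun x hx => ?_
    have hx' := mem_image_of_mem g hx
    have := h _ (hk _ hx') _ hx
    rw [hgk _ hx', dist_self, mul_zero] at this
    exact dist_le_zero.1 this
  rw [← him]
  exact euclideanHausdorffMeasure_image_le_of_lipschitzOnWith hL d

variable {U V : Type*} [NormedAddCommGroup U] [InnerProductSpace ℝ U] [FiniteDimensional ℝ U]
  [NormedAddCommGroup V] [InnerProductSpace ℝ V]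

/-- Since `A` is bounded below, an error `δ ‖x - y‖` is a small fraction of `‖A x - A y‖`. Measuring
against `A` itself allows comparison constants arbitrarily close to 1. -/
theorem exists_delta_dist_comparison {A : U →L[ℝ] V} (hA : Function.Injective A) {K : ℝ≥0}
    (hK : 1 < K) : ∃ δ : ℝ≥0, 0 < δ ∧ ∀ (g : U → V) (s : Set U), ApproximatesLinearOn g A s δ →
      (∀ x ∈ s, ∀ y ∈ s, dist (g x) (g y) ≤ K * dist (A x) (A y)) ∧
      (∀ x ∈ s, ∀ y ∈ s, dist (A x) (A y) ≤ K * dist (g x) (g y)) := by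
  obtain ⟨c, hc, hcA⟩ := (A : U →ₗ[ℝ] V).exists_antilipschitzWith (LinearMap.ker_eq_bot.2 hA)
  have hc' : (0 : ℝ) < c := hc
  have hK' : (1 : ℝ) < K := hK
  have hKpos : (0 : ℝ) < K := by linarith
  -- With `c` the antilipschitz constant of `A`, this makes the relative error `(K - 1) / K`: then
  -- `1 + (K - 1) / K ≤ K`, and `1 - (K - 1) / K = 1 / K`.
  refine ⟨⟨(K - 1) / (c * K), by have := sub_pos.2 hK'; positivity⟩, ?_, fun g s hs => ?_⟩
  · have := sub_pos.2 hK'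
    change (0 : ℝ) < (K - 1) / (c * K)
    positivity
  have key : ∀ x ∈ s, ∀ y ∈ s,
      ‖g x - g y - (A x - A y)‖ ≤ (K - 1) / K * ‖A x - A y‖ := by
    intro x hx y hy
    have h1 := hs x hx y hy
    rw [map_sub] at h1
    have h2 := hcA.le_mul_dist x y
    simp only [dist_eq_norm, ContinuousLinearMap.coe_coe] at h2
    refine h1.trans ?_
    calc (K - 1) / (c * K) * ‖x - y‖ ≤ (K - 1) / (c * K) * (c * ‖A x - A y‖) := by
          have := sub_pos.2 hK'
          gcongr
      _ = (K - 1) / K * ‖A x - A y‖ := by field_simp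
  constructor
  · intro x hx y hy
    rw [dist_eq_norm, dist_eq_norm]
    have h1 := key x hx y hy
    have h2 : ‖g x - g y‖ ≤ ‖g x - g y - (A x - A y)‖ + ‖A x - A y‖ := norm_le_norm_sub_add _ _
    have h3 : (K - 1 : ℝ) / K ≤ K - 1 := div_le_self (by linarith) hK'.le
    nlinarith [norm_nonneg (A x - A y)]
  · intro x hx y hy
    rw [dist_eq_norm, dist_eq_norm]
    have h1 := key x hx y hy
    have h2 : ‖A x - A y‖ ≤ ‖A x - A y - (g x - g y)‖ + ‖g x - g y‖ := norm_le_norm_sub_add _ _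
    rw [norm_sub_rev (A x - A y)] at h2
    have h4 : (K - 1 : ℝ) / K * ‖A x - A y‖ = ‖A x - A y‖ - ‖A x - A y‖ / K := by
      field_simp
    have h5 : ‖A x - A y‖ / K ≤ ‖g x - g y‖ := by linarith
    rwa [div_le_iff₀' hKpos] at h5

theorem continuous_normDet : Continuous fun A : U →L[ℝ] V => (A : U →ₗ[ℝ] V).normDet := by
  have h : (fun A : U →L[ℝ] V => (A : U →ₗ[ℝ] V).normDet) = fun A : U →L[ℝ] V =>
      √(Matrix.gram ℝ (fun i => A (stdOrthonormalBasis ℝ U i))).det := by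
    ext A
    have := (A : U →ₗ[ℝ] V).normDet_sq_eq_det_gram (stdOrthonormalBasis ℝ U)
    simp only [ContinuousLinearMap.coe_coe, RCLike.ofReal_real_eq_id, id] at this
    rw [← this, Real.sqrt_sq (LinearMap.normDet_nonneg _)]
  rw [h]
  refine Continuous.sqrt (Continuous.matrix_det (continuous_matrix fun i j => ?_))
  simp only [Matrix.gram_apply]
  fun_prop

theorem aemeasurable_toNNReal_normDet [MeasurableSpace U] [BorelSpace U]
    {g' : U → U →L[ℝ] V} {D : Set U} (hg' : ContinuousOn g' D) {s : Set U} (hs : s ⊆ D)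
    (hsm : MeasurableSet s) :
    AEMeasurable (fun z => ((g' z : U →ₗ[ℝ] V).normDet).toNNReal) (volume.restrict s) :=
  ((continuous_normDet.comp_continuousOn (hg'.mono hs)).aemeasurable hsm).real_toNNReal

variable [MeasurableSpace U] [BorelSpace U] [MeasurableSpace V] [BorelSpace V]

variable {g : U → V} {g' : U → U →L[ℝ] V} {O H D : Set U}

/-- For the linear map `g' y` the formula is exact. Replacing `g` by `g' y` distorts distances by at
most `K`, which costs `K ^ n` in measure; the oscillation of the Jacobian costs the last factor `K`.
-/
theorem exists_nhdsWithin_area_comparison (hO : IsOpen O) (hH : Convex ℝ H) (hD : D = O ∩ H)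
    (hg : ∀ y ∈ D, HasFDerivWithinAt g (g' y) D y) (hg' : ContinuousOn g' D)
    {y : U} (hy : y ∈ D) (hinj : Function.Injective (g' y)) {K : ℝ≥0} (hK : 1 < K) :
    ∃ u ∈ 𝓝[D] y, ∀ s ⊆ D ∩ u, MeasurableSet s →
      μHE[Module.finrank ℝ U] (g '' s) ≤
        (K : ℝ≥0∞) ^ (Module.finrank ℝ U + 1) *
          ∫⁻ z in s, ENNReal.ofReal (g' z : U →ₗ[ℝ] V).normDet ∧
      ∫⁻ z in s, ENNReal.ofReal (g' z : U →ₗ[ℝ] V).normDet ≤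
        (K : ℝ≥0∞) ^ (Module.finrank ℝ U + 1) * μHE[Module.finrank ℝ U] (g '' s) := by
  set n := Module.finrank ℝ U
  obtain ⟨δ, hδ, hcomp⟩ := exists_delta_dist_comparison hinj hK
  set j : U → ℝ := fun z => (g' z : U →ₗ[ℝ] V).normDet with hj
  have hjc : ContinuousOn j D := continuous_normDet.comp_continuousOn hg'
  have hjpos : 0 < j y := by
    refine lt_of_le_of_ne (LinearMap.normDet_nonneg _) fun h => ?_
    exact LinearMap.normDet_eq_zero_iff_ker_ne_bot.1 h.symm (LinearMap.ker_eq_bot.2 hinj)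
  have hK' : (1 : ℝ) < K := hK
  have e1 : ∀ᶠ z in 𝓝[D] y, j z < K * j y :=
    (hjc y hy).eventually_lt_const (by nlinarith)
  have e2 : ∀ᶠ z in 𝓝[D] y, j y < K * j z := by
    refine (continuousWithinAt_const.mul (hjc y hy)).eventually_const_lt (u := j y) ?_
    change j y < K * j y
    nlinarith
  have e3 : ∀ᶠ z in 𝓝[D] y, dist (g' z) (g' y) < δ :=
    (hg' y hy).eventually (Metric.ball_mem_nhds _ hδ)
  have e4 : ∀ᶠ z in 𝓝[D] y, z ∈ O :=
    mem_nhdsWithin_of_mem_nhds (hO.mem_nhds (hD ▸ hy : y ∈ O ∩ H).1)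
  obtain ⟨r, hr, hball⟩ := Metric.mem_nhdsWithin_iff.1 (e1.and (e2.and (e3.and e4)))
  obtain ⟨r', hr', hball'⟩ := Metric.isOpen_iff.1 hO y (hD ▸ hy : y ∈ O ∩ H).1
  set ρ := min r r'
  have hρ : 0 < ρ := lt_min hr hr'
  have hsub : Metric.ball y ρ ∩ H ⊆ D := by
    rw [hD]
    exact inter_subset_inter_left _
      ((Metric.ball_subset_ball (min_le_right _ _)).trans hball')
  have hDsub : D ∩ Metric.ball y ρ ⊆ Metric.ball y ρ ∩ H := by
    rw [hD]; exact fun z hz => ⟨hz.2, hz.1.2⟩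
  have hprop : ∀ z ∈ Metric.ball y ρ ∩ H, j z < K * j y ∧ j y < K * j z ∧ dist (g' z) (g' y) < δ :=
    fun z hz => by
      have := hball ⟨Metric.ball_subset_ball (min_le_left _ _) hz.1, hsub hz⟩
      exact ⟨this.1, this.2.1, this.2.2.1⟩
  -- The mean value inequality needs a convex set: once the ball lies in `O`, its trace on `D` is
  -- its intersection with the convex `H`.
  have happ : ApproximatesLinearOn g (g' y) (Metric.ball y ρ ∩ H) δ := by
    intro x hx z hz
    refine Convex.norm_image_sub_le_of_norm_hasFDerivWithin_le' (𝕜 := ℝ)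
      (fun w hw => (hg w (hsub hw)).mono hsub) (fun w hw => ?_)
      ((convex_ball y ρ).inter hH) hz hx
    rw [← dist_eq_norm]
    exact (hprop w hw).2.2.le
  obtain ⟨hc1, hc2⟩ := hcomp g _ happ
  refine ⟨Metric.ball y ρ, mem_nhdsWithin_of_mem_nhds (Metric.ball_mem_nhds _ hρ),
    fun s hs hsm => ?_⟩
  have hs' : s ⊆ Metric.ball y ρ ∩ H := hs.trans hDsub
  have hlin : μHE[n] (g' y '' s) = ENNReal.ofReal (j y) * volume s :=
    LinearMap.euclideanHausdorffMeasure_image_eq_normDet_mul_volume (g' y : U →ₗ[ℝ] V) s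
  have hKof : ENNReal.ofReal (K : ℝ) = K := ENNReal.ofReal_coe_nnreal
  constructor
  · calc μHE[n] (g '' s) ≤ (K : ℝ≥0∞) ^ n * μHE[n] (g' y '' s) :=
          euclideanHausdorffMeasure_image_le_image
            (fun x hx z hz => hc1 x (hs' hx) z (hs' hz)) n
      _ = (K : ℝ≥0∞) ^ n * ∫⁻ z in s, ENNReal.ofReal (j y) := by
          rw [hlin, setLIntegral_const]
      _ ≤ (K : ℝ≥0∞) ^ n * ∫⁻ z in s, K * ENNReal.ofReal (j z) := by
          gcongr 1
          refine setLIntegral_mono' hsm fun z hz => ?_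
          rw [← hKof, ← ENNReal.ofReal_mul (by positivity)]
          exact ENNReal.ofReal_le_ofReal (hprop z (hs' hz)).2.1.le
      _ = (K : ℝ≥0∞) ^ (n + 1) * ∫⁻ z in s, ENNReal.ofReal (j z) := by
          rw [lintegral_const_mul' _ _ ENNReal.coe_ne_top, pow_succ, mul_assoc]
  · calc ∫⁻ z in s, ENNReal.ofReal (j z) ≤ ∫⁻ z in s, K * ENNReal.ofReal (j y) := by
          refine setLIntegral_mono' hsm fun z hz => ?_
          rw [← hKof, ← ENNReal.ofReal_mul (by positivity)]
          exact ENNReal.ofReal_le_ofReal (hprop z (hs' hz)).1.le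
      _ = K * μHE[n] (g' y '' s) := by rw [setLIntegral_const, hlin, mul_assoc]
      _ ≤ K * ((K : ℝ≥0∞) ^ n * μHE[n] (g '' s)) := by
          gcongr
          exact euclideanHausdorffMeasure_image_le_image
            (fun x hx z hz => hc2 x (hs' hx) z (hs' hz)) n
      _ = (K : ℝ≥0∞) ^ (n + 1) * μHE[n] (g '' s) := by rw [pow_succ', mul_assoc]

theorem le_of_forall_one_lt_pow_mul_le {a b : ℝ≥0∞} (n : ℕ)
    (h : ∀ K : ℝ≥0, 1 < K → a ≤ (K : ℝ≥0∞) ^ n * b) : a ≤ b := by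
  have ht : Tendsto (fun K : ℝ≥0 => (K : ℝ≥0∞) ^ n * b) (𝓝[>] 1)
      (𝓝 (((1 : ℝ≥0) : ℝ≥0∞) ^ n * b)) := by
    refine ENNReal.Tendsto.mul_const ?_ (Or.inl (by simp))
    exact ((ENNReal.continuous_pow n).comp ENNReal.continuous_coe).continuousWithinAt
  simp only [ENNReal.coe_one, one_pow, one_mul] at ht
  exact ge_of_tendsto ht (eventually_mem_nhdsWithin.mono h)

/-- **Area formula**, set version: the Hausdorff measure of the image of a `C¹` injective
immersion. -/
theorem euclideanHausdorffMeasure_image_eq_lintegral (hO : IsOpen O) (hH : Convex ℝ H)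
    (hD : D = O ∩ H) (hg : ∀ y ∈ D, HasFDerivWithinAt g (g' y) D y)
    (hg' : ContinuousOn g' D) (hinj' : ∀ y ∈ D, Function.Injective (g' y)) (hinj : InjOn g D)
    {s : Set U} (hs : s ⊆ D) (hsm : MeasurableSet s) :
    μHE[Module.finrank ℝ U] (g '' s) =
      ∫⁻ z in s, ENNReal.ofReal (g' z : U →ₗ[ℝ] V).normDet := by
  set n := Module.finrank ℝ U
  have hgc : ContinuousOn g D := fun y hy => (hg y hy).continuousWithinAt
  suffices h : ∀ K : ℝ≥0, 1 < K →
      μHE[n] (g '' s) ≤ (K : ℝ≥0∞) ^ (n + 1) *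
        ∫⁻ z in s, ENNReal.ofReal (g' z : U →ₗ[ℝ] V).normDet ∧
      ∫⁻ z in s, ENNReal.ofReal (g' z : U →ₗ[ℝ] V).normDet ≤
        (K : ℝ≥0∞) ^ (n + 1) * μHE[n] (g '' s) from
    le_antisymm (le_of_forall_one_lt_pow_mul_le _ fun K hK => (h K hK).1)
      (le_of_forall_one_lt_pow_mul_le _ fun K hK => (h K hK).2)
  intro K hK
  choose! u hu hcomp using fun y (hy : y ∈ D) =>
    exists_nhdsWithin_area_comparison hO hH hD hg hg' hy (hinj' y hy) hK
  choose! w hwo hyw hw using fun y (hy : y ∈ D) => mem_nhdsWithin.1 (hu y hy)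
  obtain ⟨t, htD, htc, hcov⟩ := TopologicalSpace.countable_cover_nhdsWithin
    (f := w) (s := D) fun y hy =>
      mem_nhdsWithin_of_mem_nhds ((hwo y hy).mem_nhds (hyw y hy))
  rcases t.eq_empty_or_nonempty with rfl | hne
  · have : s = ∅ := subset_empty_iff.1 (hs.trans (by simpa using hcov))
    simp [this]
  obtain ⟨e, rfl⟩ := htc.exists_eq_range hne
  have heD : ∀ k, e k ∈ D := fun k => htD (mem_range_self k)
  -- Disjoint pieces make both sides countably additive; injectivity of `g` keeps their images
  -- disjoint and Borel.
  set v : ℕ → Set U := fun k => s ∩ disjointed (fun k => w (e k)) k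
  have hvm : ∀ k, MeasurableSet (v k) := fun k =>
    hsm.inter (MeasurableSet.disjointed (fun k => (hwo _ (heD k)).measurableSet) k)
  have hvd : Pairwise (Function.onFun Disjoint v) := fun i k hik =>
    ((disjoint_disjointed (fun k => w (e k))) hik).mono inter_subset_right inter_subset_right
  have hvD : ∀ k, v k ⊆ D := fun k => inter_subset_left.trans hs
  have hvs : s = ⋃ k, v k := by
    rw [← inter_iUnion, iUnion_disjointed, eq_comm, inter_eq_left]
    refine hs.trans (hcov.trans ?_)
    simp
  have hvu : ∀ k, v k ⊆ D ∩ u (e k) := fun k z hz =>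
    ⟨hs hz.1, hw _ (heD k) ⟨disjointed_subset (fun k => w (e k)) k hz.2, hs hz.1⟩⟩
  have him : μHE[n] (g '' s) = ∑' k, μHE[n] (g '' v k) := by
    rw [hvs, image_iUnion, measure_iUnion]
    · intro i k hik
      rw [Function.onFun, disjoint_left]
      rintro _ ⟨x, hx, rfl⟩ ⟨z, hz, hzx⟩
      rw [hinj (hvD k hz) (hvD i hx) hzx] at hz
      exact disjoint_left.1 (hvd hik) hx hz
    · exact fun k => (hvm k).image_of_continuousOn_injOn (hgc.mono (hvD k)) (hinj.mono (hvD k))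
  have hint : ∫⁻ z in s, ENNReal.ofReal (g' z : U →ₗ[ℝ] V).normDet =
      ∑' k, ∫⁻ z in v k, ENNReal.ofReal (g' z : U →ₗ[ℝ] V).normDet := by
    conv_lhs => rw [hvs]
    rw [lintegral_iUnion hvm hvd]
  rw [him, hint, ← ENNReal.tsum_mul_left, ← ENNReal.tsum_mul_left]
  exact ⟨ENNReal.tsum_le_tsum fun k => (hcomp _ (heD k) _ (hvu k) (hvm k)).1,
    ENNReal.tsum_le_tsum fun k => (hcomp _ (heD k) _ (hvu k) (hvm k)).2⟩

/-- **Area formula**: change of variables in the image of a `C¹` injective immersion. -/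
theorem map_withDensity_normDet (hO : IsOpen O) (hH : Convex ℝ H)
    (hD : D = O ∩ H) (hg : ∀ y ∈ D, HasFDerivWithinAt g (g' y) D y)
    (hg' : ContinuousOn g' D) (hinj' : ∀ y ∈ D, Function.Injective (g' y)) (hinj : InjOn g D)
    {s : Set U} (hs : s ⊆ D) (hsm : MeasurableSet s) :
    Measure.map (s.domRestrict g) (Measure.comap (↑)
      (volume.withDensity fun z => ENNReal.ofReal (g' z : U →ₗ[ℝ] V).normDet)) =
      (μHE[Module.finrank ℝ U]).restrict (g '' s) := by
  have hgc : ContinuousOn g s := fun y hy => ((hg y (hs hy)).mono hs).continuousWithinAt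
  have hemb := hgc.measurableEmbedding hsm (hinj.mono hs)
  ext t ht
  have hpre : MeasurableSet ((↑) '' (s.domRestrict g ⁻¹' t) : Set U) :=
    hsm.subtype_image (hemb.measurable ht)
  have hpre' : ((↑) '' (s.domRestrict g ⁻¹' t) : Set U) = s ∩ g ⁻¹' t := by
    ext x; simp [and_comm]
  rw [hemb.map_apply, (MeasurableEmbedding.subtype_coe hsm).comap_apply, withDensity_apply _ hpre,
    Measure.restrict_apply ht, ← euclideanHausdorffMeasure_image_eq_lintegral hO hH hD hg hg' hinj'
      hinj (hpre'.subset.trans (inter_subset_left.trans hs)) hpre, hpre',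
    image_inter_preimage, inter_comm]

theorem integrableOn_image_iff_integrableOn_normDet_smul {F : Type*} [NormedAddCommGroup F]
    [NormedSpace ℝ F] (hO : IsOpen O) (hH : Convex ℝ H)
    (hD : D = O ∩ H) (hg : ∀ y ∈ D, HasFDerivWithinAt g (g' y) D y)
    (hg' : ContinuousOn g' D) (hinj' : ∀ y ∈ D, Function.Injective (g' y)) (hinj : InjOn g D)
    {s : Set U} (hs : s ⊆ D) (hsm : MeasurableSet s) (h : V → F) :
    IntegrableOn h (g '' s) μHE[Module.finrank ℝ U] ↔
      IntegrableOn (fun z => (g' z : U →ₗ[ℝ] V).normDet • h (g z)) s := by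
  have hgc : ContinuousOn g s := fun y hy => ((hg y (hs hy)).mono hs).continuousWithinAt
  have hemb := hgc.measurableEmbedding hsm (hinj.mono hs)
  rw [IntegrableOn, ← map_withDensity_normDet hO hH hD hg hg' hinj' hinj hs hsm,
    hemb.integrable_map_iff]
  simp only [Set.domRestrict_eq, ← Function.comp_assoc, ENNReal.ofReal]
  rw [← (MeasurableEmbedding.subtype_coe hsm).integrable_map_iff, map_comap_subtype_coe hsm,
    restrict_withDensity hsm, integrable_withDensity_iff_integrable_coe_smul₀
      (aemeasurable_toNNReal_normDet hg' hs hsm)]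
  simp_rw [IntegrableOn, Real.coe_toNNReal _ (LinearMap.normDet_nonneg _), Function.comp_apply]

theorem integral_image_eq_integral_normDet_smul {F : Type*} [NormedAddCommGroup F]
    [NormedSpace ℝ F] (hO : IsOpen O) (hH : Convex ℝ H)
    (hD : D = O ∩ H) (hg : ∀ y ∈ D, HasFDerivWithinAt g (g' y) D y)
    (hg' : ContinuousOn g' D) (hinj' : ∀ y ∈ D, Function.Injective (g' y)) (hinj : InjOn g D)
    {s : Set U} (hs : s ⊆ D) (hsm : MeasurableSet s) (h : V → F) :
    ∫ x in g '' s, h x ∂μHE[Module.finrank ℝ U] =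
      ∫ z in s, (g' z : U →ₗ[ℝ] V).normDet • h (g z) := by
  have hgc : ContinuousOn g s := fun y hy => ((hg y (hs hy)).mono hs).continuousWithinAt
  have hemb := hgc.measurableEmbedding hsm (hinj.mono hs)
  rw [← map_withDensity_normDet hO hH hD hg hg' hinj' hinj hs hsm, hemb.integral_map]
  simp only [Set.domRestrict_apply, ← Function.comp_apply (f := h), ENNReal.ofReal]
  rw [← (MeasurableEmbedding.subtype_coe hsm).integral_map
      (g := fun z => (h ∘ g) z), map_comap_subtype_coe hsm,
    setIntegral_withDensity_eq_setIntegral_smul₀ (aemeasurable_toNNReal_normDet hg' hs hsm) _ hsm]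
  congr with x
  rw [NNReal.smul_def, Real.coe_toNNReal _ (LinearMap.normDet_nonneg _), Function.comp_apply]

end AreaFormula

/-! ### Slices of derivatives and differentiation under the integral sign -/

section ParametricIntegral

variable {U : Type*} [NormedAddCommGroup U]

theorem hasDerivWithinAt_slice [NormedSpace ℝ U]
    {F : Type*} [NormedAddCommGroup F] [NormedSpace ℝ F]
    {G : ℝ × U → F} {L : ℝ × U →L[ℝ] F} {I : Set ℝ} {D : Set U} {t : ℝ} {y : U}
    (h : HasFDerivWithinAt G L (I ×ˢ D) (t, y)) (hy : y ∈ D) :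
    HasDerivWithinAt (fun s => G (s, y)) (L (1, 0)) I t := by
  have h1 : HasDerivWithinAt (fun s : ℝ => (s, y)) ((1 : ℝ), (0 : U)) I t :=
    (hasDerivWithinAt_id t I).prodMk (hasDerivWithinAt_const t I y)
  exact h.comp_hasDerivWithinAt t h1 (fun s hs => (⟨hs, hy⟩ : (s, y) ∈ I ×ˢ D))

theorem hasFDerivWithinAt_slice [NormedSpace ℝ U]
    {F : Type*} [NormedAddCommGroup F] [NormedSpace ℝ F]
    {G : ℝ × U → F} {L : ℝ × U →L[ℝ] F} {I : Set ℝ} {D : Set U} {t : ℝ} {y : U}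
    (h : HasFDerivWithinAt G L (I ×ˢ D) (t, y)) (ht : t ∈ I) :
    HasFDerivWithinAt (fun z => G (t, z)) (L.comp (ContinuousLinearMap.inr ℝ ℝ U)) D y := by
  have h1 : HasFDerivWithinAt (fun z : U => (t, z)) (ContinuousLinearMap.inr ℝ ℝ U) D y :=
    (hasFDerivWithinAt_const t y D).prodMk (hasFDerivWithinAt_id y D)
  exact h.comp y h1 fun s hs => ⟨ht, hs⟩

/-- Differentiation under the integral sign, over a subset of a compact set, within an interval. -/
theorem hasDerivWithinAt_setIntegral_of_continuousOn [MeasurableSpace U] [BorelSpace U]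
    (μ : Measure U) [IsFiniteMeasureOnCompacts μ] {I : Set ℝ} (hI : I.OrdConnected)
    {B C : Set U} (hC : IsCompact C) (hBC : B ⊆ C) (hB : MeasurableSet B)
    {P P' : ℝ → U → ℝ} (hP : ∀ t ∈ I, ContinuousOn (P t) C)
    (hP' : ContinuousOn (fun q : ℝ × U => P' q.1 q.2) (I ×ˢ C))
    (hd : ∀ t ∈ I, ∀ y ∈ C, HasDerivWithinAt (fun s => P s y) (P' t y) I t) {t : ℝ} (ht : t ∈ I) :
    HasDerivWithinAt (fun s => ∫ y in B, P s y ∂μ) (∫ y in B, P' t y ∂μ) I t := by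
  have hint : ∀ s ∈ I, IntegrableOn (P s) B μ := fun s hs =>
    ((hP s hs).integrableOn_compact hC).mono_set hBC
  have hcont : ContinuousOn (P' t) C :=
    hP'.comp (by fun_prop : ContinuousOn (fun y : U => (t, y)) C) fun y hy =>
      (⟨ht, hy⟩ : (t, y) ∈ I ×ˢ C)
  obtain ⟨M, hM⟩ := (hC.image_of_continuousOn hcont).isBounded.exists_norm_le
  -- `M` bounds `P'` at time `t` only; by the tube lemma over the compact `C`, `M + 1` is a bound at
  -- all nearby times. By the mean value inequality it then dominates the difference quotients.
  have hev : ∀ᶠ s in 𝓝[I] t, ∀ y ∈ C, ‖P' s y‖ ≤ M + 1 := by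
    have hn : {q : ℝ × U | ‖P' q.1 q.2‖ ≤ M + 1} ∈ 𝓝ˢ[I ×ˢ C] ({t} ×ˢ C) := by
      obtain ⟨v, hv, hveq⟩ := continuousOn_iff'.1 hP'.norm (Iio (M + 1)) isOpen_Iio
      refine mem_nhdsSetWithin.2 ⟨v, hv, ?_, fun q hq => ?_⟩
      · rintro ⟨s, y⟩ ⟨rfl, hy⟩
        have : (s, y) ∈ (fun q : ℝ × U => ‖P' q.1 q.2‖) ⁻¹' Iio (M + 1) ∩ I ×ˢ C :=
          ⟨(hM _ (mem_image_of_mem _ hy)).trans_lt (lt_add_one M), ht, hy⟩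
        exact (hveq ▸ this : _ ∈ v ∩ I ×ˢ C).1
      · have : q ∈ (fun q : ℝ × U => ‖P' q.1 q.2‖) ⁻¹' Iio (M + 1) ∩ I ×ˢ C := hveq ▸ hq
        exact le_of_lt (show ‖P' q.1 q.2‖ < M + 1 from this.1)
    obtain ⟨u, hu, huC⟩ := generalized_tube_lemma_left isCompact_singleton hC hn
    rw [nhdsSetWithin_singleton] at hu
    filter_upwards [hu] with s hs y hy using huC (⟨hs, hy⟩ : (s, y) ∈ u ×ˢ C)
  obtain ⟨r, hr, hball⟩ := Metric.mem_nhdsWithin_iff.1 hev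
  have hconv : Convex ℝ (Metric.ball t r ∩ I) := (convex_ball t r).inter hI.convex
  rw [hasDerivWithinAt_iff_tendsto_slope]
  have hmem : ∀ᶠ s in 𝓝[I \ {t}] t, s ∈ Metric.ball t r ∩ I ∧ s ≠ t := by
    filter_upwards [mem_nhdsWithin_of_mem_nhds (Metric.ball_mem_nhds t hr),
      self_mem_nhdsWithin] with s h1 h2 using ⟨⟨h1, h2.1⟩, h2.2⟩
  have hlim : Tendsto (fun s => ∫ y in B, slope (fun s => P s y) t s ∂μ) (𝓝[I \ {t}] t)
      (𝓝 (∫ y in B, P' t y ∂μ)) := by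
    refine tendsto_integral_filter_of_dominated_convergence (fun _ => M + 1) ?_ ?_ ?_ ?_
    · filter_upwards [hmem] with s hs
      exact (((hint s hs.1.2).sub (hint t ht)).smul (s - t)⁻¹).aestronglyMeasurable
    · filter_upwards [hmem] with s hs
      refine (ae_restrict_iff' hB).2 (Eventually.of_forall fun y hy => ?_)
      have := hconv.norm_image_sub_le_of_norm_hasDerivWithin_le (C := M + 1)
        (f := fun s => P s y) (f' := fun s => P' s y)
        (fun x hx => (hd x hx.2 y (hBC hy)).mono inter_subset_right)
        (fun x hx => hball hx y (hBC hy)) ⟨Metric.mem_ball_self hr, ht⟩ hs.1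
      rw [slope_def_field, norm_div]
      exact div_le_of_le_mul₀ (norm_nonneg _)
        ((norm_nonneg _).trans (hball ⟨Metric.mem_ball_self hr, ht⟩ y (hBC hy))) this
    · exact integrableOn_const (hs := ((measure_mono hBC).trans_lt hC.measure_lt_top).ne)
    · refine (ae_restrict_iff' hB).2 (Eventually.of_forall fun y hy => ?_)
      exact hasDerivWithinAt_iff_tendsto_slope.1 (hd t ht y (hBC hy))
  refine hlim.congr' ?_
  filter_upwards [hmem] with s hs
  simp only [slope, vsub_eq_sub]
  rw [integral_smul, integral_sub (hint s hs.1.2) (hint t ht)]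

end ParametricIntegral

/-! ### Tangent space, surface divergence and surface gradient in a parametrization -/

section TangentSpace

variable {U : Type*} [NormedAddCommGroup U] [NormedSpace ℝ U]
  {S : Set E3} {D : Set U} {g : U → E3} {k : E3 → U} {g' : U →L[ℝ] E3} {k' : E3 →L[ℝ] U} {y : U}

/-- A parametrization `g : D → S` near `g y`, together with its inverse `k`, and
their derivatives `g'` at `y` and `k'` at `g y`. -/
structure IsParametrizationAt (S : Set E3) (D : Set U) (g : U → E3) (k : E3 → U)
    (g' : U →L[ℝ] E3) (k' : E3 →L[ℝ] U) (y : U) : Prop where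
  mem : y ∈ D
  uniqueDiff : UniqueDiffWithinAt ℝ D y
  mapsTo : MapsTo g D S
  leftInv : LeftInvOn k g D
  rightInv : ∀ᶠ z in 𝓝[S] g y, k z ∈ D ∧ g (k z) = z
  deriv : HasFDerivWithinAt g g' D y
  deriv_inv : HasFDerivWithinAt k k' S (g y)

namespace IsParametrizationAt

theorem deriv_inv_apply (h : IsParametrizationAt S D g k g' k' y) (v : U) : k' (g' v) = v := by
  have h1 : HasFDerivWithinAt (k ∘ g) (k'.comp g') D y := h.deriv_inv.comp y h.deriv h.mapsTo
  have h2 : HasFDerivWithinAt (k ∘ g) (ContinuousLinearMap.id ℝ U) D y :=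
    (hasFDerivWithinAt_id y D).congr (fun z hz => h.leftInv hz) (h.leftInv h.mem)
  exact congr($(h.uniqueDiff.eq h1 h2) v)

theorem injective (h : IsParametrizationAt S D g k g' k' y) : Function.Injective g' :=
  Function.LeftInverse.injective h.deriv_inv_apply

/-- On `S` near `g y` the map `g ∘ k` is the identity, and derivatives within `S` are unique on the
tangent cone, hence on its span. -/
theorem apply_deriv_inv (h : IsParametrizationAt S D g k g' k' y) {v : E3}
    (hv : v ∈ tangentSpace S (g y)) : g' (k' v) = v := by
  set S' := {z ∈ S | k z ∈ D ∧ g (k z) = z}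
  have hky : k (g y) = y := h.leftInv h.mem
  have hS' : S' ∈ 𝓝[S] g y := by
    filter_upwards [h.rightInv, self_mem_nhdsWithin] with z h1 h2 using ⟨h2, h1⟩
  have hmem : g y ∈ S' := ⟨h.mapsTo h.mem, by rw [hky]; exact ⟨h.mem, rfl⟩⟩
  have h1 : HasFDerivWithinAt (g ∘ k) (g'.comp k') S' (g y) := by
    refine HasFDerivWithinAt.comp (t := D) (g y) ?_ (h.deriv_inv.mono fun z hz => hz.1)
      fun z hz => hz.2.1
    rw [hky]; exact h.deriv
  have h2 : HasFDerivWithinAt id (g'.comp k') S (g y) :=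
    (h1.congr (f := g ∘ k) (f₁ := id) (fun z hz => hz.2.2.symm)
      hmem.2.2.symm).mono_of_mem_nhdsWithin hS'
  have h3 := h2.unique_on (hasFDerivWithinAt_id (g y) S)
  have h4 := LinearMap.eqOn_span (f := ((g'.comp k' : E3 →L[ℝ] E3) : E3 →ₗ[ℝ] E3))
    (g := ((ContinuousLinearMap.id ℝ E3 : E3 →L[ℝ] E3) : E3 →ₗ[ℝ] E3)) h3
  exact h4 hv

theorem deriv_mem [FiniteDimensional ℝ U] (h : IsParametrizationAt S D g k g' k' y) (v : U) :
    g' v ∈ tangentSpace S (g y) := by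
  -- Unique differentiability only makes the span dense; in finite dimension it is also closed.
  have h1 : (Submodule.span ℝ (tangentConeAt ℝ D y)) = ⊤ := by
    have h2 := h.uniqueDiff.dense_tangentConeAt
    rw [← Submodule.dense_iff_topologicalClosure_eq_top.1 h2]
    exact (Submodule.closed_of_finiteDimensional _).submodule_topologicalClosure_eq.symm
  have h2 : (Submodule.span ℝ (tangentConeAt ℝ D y)).map (g' : U →ₗ[ℝ] E3) ≤
      tangentSpace S (g y) := by
    rw [Submodule.map_span, tangentSpace]
    refine Submodule.span_mono ?_
    refine (image_subset_iff.2 h.deriv.mapsTo_tangent_cone).trans ?_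
    exact tangentConeAt_mono h.mapsTo.image_subset
  refine h2 ⟨v, ?_, rfl⟩
  rw [h1]; trivial

/-- `Y` equals `w ∘ k` on `S` near `g y`, so it is differentiable within `S` and `fderivWithin` is
not the default value 0. The chain rule and uniqueness of derivatives within `D` then fix its values
on the range of `g'`. -/
theorem fderivWithin_apply {F : Type*} [NormedAddCommGroup F] [NormedSpace ℝ F]
    (h : IsParametrizationAt S D g k g' k' y) {Y : E3 → F} {w : U → F} {w' : U →L[ℝ] F}
    (hY : ∀ z ∈ D, Y (g z) = w z) (hw : HasFDerivWithinAt w w' D y) (v : U) :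
    fderivWithin ℝ Y S (g y) (g' v) = w' v := by
  have hky : k (g y) = y := h.leftInv h.mem
  have hdY : DifferentiableWithinAt ℝ Y S (g y) := by
    set S' := {z ∈ S | k z ∈ D ∧ g (k z) = z}
    have hS' : S' ∈ 𝓝[S] g y := by
      filter_upwards [h.rightInv, self_mem_nhdsWithin] with z h1 h2 using ⟨h2, h1⟩
    have h1 : HasFDerivWithinAt (w ∘ k) (w'.comp k') S' (g y) := by
      refine HasFDerivWithinAt.comp (t := D) (g y) ?_ (h.deriv_inv.mono fun z hz => hz.1)
        fun z hz => hz.2.1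
      rw [hky]; exact hw
    have h2 : HasFDerivWithinAt Y (w'.comp k') S' (g y) := by
      refine h1.congr (fun z hz => ?_) ?_
      · rw [Function.comp_apply, ← hY _ hz.2.1, hz.2.2]
      · rw [Function.comp_apply, hky, hY _ h.mem]
    exact (h2.mono_of_mem_nhdsWithin hS').differentiableWithinAt
  have h1 : HasFDerivWithinAt w ((fderivWithin ℝ Y S (g y)).comp g') D y :=
    (hdY.hasFDerivWithinAt.comp y h.deriv h.mapsTo).congr (fun z hz => (hY z hz).symm)
      (hY y h.mem).symm
  exact congr($(h.uniqueDiff.eq h1 hw) v)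

/-- The surface divergence, computed in a parametrization. -/
theorem exists_surfaceDiv_eq_trace [FiniteDimensional ℝ U]
    (h : IsParametrizationAt S D g k g' k' y) {Y : E3 → E3} {w : U → E3} {w' : U →L[ℝ] E3}
    (hY : ∀ z ∈ D, Y (g z) = w z) (hw : HasFDerivWithinAt w w' D y) :
    ∃ M : U →ₗ[ℝ] U, surfaceDiv S Y (g y) = LinearMap.trace ℝ U M ∧
      ∀ u v, ⟪g' u, g' (M v)⟫ = ⟪g' u, w' v⟫ := by
  set T := tangentSpace S (g y) with hT
  set L : T →L[ℝ] T := T.orthogonalProjectionOnto.comp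
      ((fderivWithin ℝ Y S (g y)).comp T.subtypeL)
  let gT : U →ₗ[ℝ] T := (g' : U →ₗ[ℝ] E3).codRestrict T h.deriv_mem
  let kT : T →ₗ[ℝ] U := (k' : E3 →ₗ[ℝ] U) ∘ₗ T.subtype
  have hid : gT ∘ₗ kT = LinearMap.id := by
    ext v
    exact congr($(h.apply_deriv_inv v.2) _)
  have hLg : ∀ v, L (gT v) = T.orthogonalProjectionOnto (w' v) := fun v =>
    congr(T.orthogonalProjectionOnto $(h.fderivWithin_apply hY hw v))
  -- `M` is the endomorphism `L` of the tangent space conjugated by the parametrization, so the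
  -- traces agree by cyclicity.
  refine ⟨kT ∘ₗ (L : T →ₗ[ℝ] T) ∘ₗ gT, ?_, fun u v => ?_⟩
  · change LinearMap.trace ℝ T (L : T →ₗ[ℝ] T) = _
    rw [LinearMap.trace_comp_comm', LinearMap.comp_assoc, hid, LinearMap.comp_id]
  · change ⟪g' u, g' (k' (L (gT v) : E3))⟫ = _
    rw [h.apply_deriv_inv (L (gT v)).2, hLg]
    exact T.inner_orthogonalProjectionOnto_eq_of_mem_left ⟨g' u, h.deriv_mem u⟩ (w' v)

theorem finrank_tangentSpace [FiniteDimensional ℝ U] (h : IsParametrizationAt S D g k g' k' y) :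
    Module.finrank ℝ (tangentSpace S (g y)) = Module.finrank ℝ U := by
  have : tangentSpace S (g y) = LinearMap.range (g' : U →ₗ[ℝ] E3) := by
    ext v
    refine ⟨fun hv => ⟨k' v, h.apply_deriv_inv hv⟩, ?_⟩
    rintro ⟨u, rfl⟩
    exact h.deriv_mem u
  rw [this]
  exact LinearMap.finrank_range_of_inj h.injective

end IsParametrizationAt

/-- The surface gradient is the tangential part of the gradient. -/
theorem surfaceGrad_eq_orthogonalProjection {S : Set E3} {f : E3 → ℝ} {x : E3}
    (hf : DifferentiableAt ℝ f x) :
    surfaceGrad S f x = (tangentSpace S x).orthogonalProjectionOnto (gradient f x) := by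
  rw [surfaceGrad]
  congr 1
  rw [LinearIsometryEquiv.symm_apply_eq]
  ext v
  have hu := LinearMap.eqOn_span (f := (fderivWithin ℝ f S x : E3 →ₗ[ℝ] ℝ))
    (g := (fderiv ℝ f x : E3 →ₗ[ℝ] ℝ)) (hf.differentiableWithinAt.hasFDerivWithinAt.unique_on
      (s := S) hf.hasFDerivAt.hasFDerivWithinAt) v.2
  simp only [ContinuousLinearMap.coe_coe] at hu
  simp only [ContinuousLinearMap.comp_apply, Submodule.subtypeL_apply,
    InnerProductSpace.toDual_apply_apply]
  rw [hu, Submodule.inner_orthogonalProjectionOnto_eq_of_mem_right, gradient,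
    InnerProductSpace.toDual_symm_apply]

/-- A two-dimensional tangent space fills the orthogonal complement of `ν`, so a gradient orthogonal
to `ν` is already tangent. -/
theorem surfaceGrad_eq_gradient {S : Set E3} {f : E3 → ℝ} {x ν : E3}
    (hf : DifferentiableAt ℝ f x) (hrank : Module.finrank ℝ (tangentSpace S x) = 2)
    (hν : IsUnitNormal S x ν) (hνf : ⟪ν, gradient f x⟫ = 0) :
    surfaceGrad S f x = gradient f x := by
  rw [surfaceGrad_eq_orthogonalProjection hf, Submodule.coe_orthogonalProjectionOnto_apply,
    Submodule.starProjection_eq_self_iff]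
  set T := tangentSpace S x
  have hν0 : ν ≠ 0 := fun h => by simpa [h] using hν.1
  have hle : T ≤ (ℝ ∙ ν)ᗮ := fun v hv =>
    Submodule.mem_orthogonal_singleton_iff_inner_right.2 (hν.2 v hv)
  have heq : T = (ℝ ∙ ν)ᗮ := by
    refine Submodule.eq_of_le_of_finrank_eq hle ?_
    have : Fact (Module.finrank ℝ E3 = 2 + 1) := ⟨by simp⟩
    rw [hrank, Submodule.finrank_orthogonal_span_singleton (n := 2) hν0]
  rw [heq]
  exact Submodule.mem_orthogonal_singleton_iff_inner_right.2 hνf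

end TangentSpace

/-! ### The area element as root of a Gram determinant, and its derivative -/

section GramDeterminant

variable {V : Type*} [NormedAddCommGroup V] [InnerProductSpace ℝ V]

theorem normDet_eq_sqrt (A : E2 →L[ℝ] V) : (A : E2 →ₗ[ℝ] V).normDet =
    √(⟪A (EuclideanSpace.single 0 1), A (EuclideanSpace.single 0 1)⟫ *
        ⟪A (EuclideanSpace.single 1 1), A (EuclideanSpace.single 1 1)⟫ -
      ⟪A (EuclideanSpace.single 0 1), A (EuclideanSpace.single 1 1)⟫ ^ 2) := by
  have := (A : E2 →ₗ[ℝ] V).normDet_sq_eq_det_gram (EuclideanSpace.basisFun (Fin 2) ℝ)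
  simp only [ContinuousLinearMap.coe_coe, RCLike.ofReal_real_eq_id, id, Matrix.det_fin_two,
    Matrix.gram_apply, EuclideanSpace.basisFun_apply] at this
  rw [real_inner_comm (A (EuclideanSpace.single 0 1)) (A (EuclideanSpace.single 1 1)), ← sq] at this
  rw [← this, Real.sqrt_sq (LinearMap.normDet_nonneg _)]

theorem normDet_pos {A : E2 →L[ℝ] V} (hA : Function.Injective A) :
    0 < (A : E2 →ₗ[ℝ] V).normDet := by
  refine lt_of_le_of_ne (LinearMap.normDet_nonneg _) fun h => ?_
  exact LinearMap.normDet_eq_zero_iff_ker_ne_bot.1 h.symm (LinearMap.ker_eq_bot.2 hA)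

theorem contDiffAt_normDet {A : E2 →L[ℝ] V} (hA : Function.Injective A) {n : ℕ∞ω} :
    ContDiffAt ℝ n (fun A : E2 →L[ℝ] V => (A : E2 →ₗ[ℝ] V).normDet) A := by
  have h := normDet_pos hA
  simp only [normDet_eq_sqrt] at h ⊢
  refine ContDiffAt.sqrt ?_ (Real.sqrt_pos.1 h).ne'
  have (v : E2) : ContDiff ℝ n fun A : E2 →L[ℝ] V => A v := contDiff_id.clm_apply contDiff_const
  exact ((((this _).inner ℝ (this _)).mul ((this _).inner ℝ (this _))).sub
    (((this _).inner ℝ (this _)).pow 2)).contDiffAt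

/-- Jacobi's formula for the Gram determinant `Δ`. Its derivative involves `A'` only through inner
products with the range of `A t`, so `A'` may be replaced by `A t ∘ M`; this gives `Δ' = 2 (tr M)
Δ`. -/
theorem hasDerivWithinAt_normDet {A : ℝ → E2 →L[ℝ] V} {A' : E2 →L[ℝ] V} {I : Set ℝ} {t : ℝ}
    (hA : ∀ v, HasDerivWithinAt (fun s => A s v) (A' v) I t) (hinj : Function.Injective (A t))
    {M : E2 →ₗ[ℝ] E2} (hM : ∀ u v, ⟪A t u, A t (M v)⟫ = ⟪A t u, A' v⟫) :
    HasDerivWithinAt (fun s => (A s : E2 →ₗ[ℝ] V).normDet)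
      ((A t : E2 →ₗ[ℝ] V).normDet * LinearMap.trace ℝ E2 M) I t := by
  have h := normDet_pos hinj
  simp only [normDet_eq_sqrt] at h ⊢
  set e₀ : E2 := EuclideanSpace.single 0 1
  set e₁ : E2 := EuclideanSpace.single 1 1
  have hdec : ∀ v : E2, v = v 0 • e₀ + v 1 • e₁ := fun v => by
    ext i
    fin_cases i <;> simp [e₀, e₁]
  have htr : LinearMap.trace ℝ E2 M = M e₀ 0 + M e₁ 1 := by
    rw [LinearMap.trace_eq_sum_inner M (EuclideanSpace.basisFun (Fin 2) ℝ)]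
    simp [e₀, e₁, EuclideanSpace.inner_single_left]
  have hexp : ∀ u v, ⟪A t u, A' v⟫ = M v 0 * ⟪A t u, A t e₀⟫ + M v 1 * ⟪A t u, A t e₁⟫ := by
    intro u v
    rw [← hM u v]
    conv_lhs => rw [hdec (M v)]
    simp only [map_add, map_smul, inner_add_right, inner_smul_right]
  have hd := ((((hA e₀).inner ℝ (hA e₀)).mul ((hA e₁).inner ℝ (hA e₁))).sub
    (((hA e₀).inner ℝ (hA e₁)).pow 2)).sqrt (Real.sqrt_pos.1 h).ne'
  refine hd.congr_deriv ?_
  simp only [Pi.mul_apply, Pi.sub_apply, Pi.pow_apply]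
  set Δ := ⟪A t e₀, A t e₀⟫ * ⟪A t e₁, A t e₁⟫ - ⟪A t e₀, A t e₁⟫ ^ 2
  rw [div_eq_iff (by positivity), htr]
  have hs : √Δ * √Δ = Δ := Real.mul_self_sqrt (Real.sqrt_pos.1 h).le
  have hs' : √Δ * (M e₀ 0 + M e₁ 1) * (2 * √Δ) = 2 * (M e₀ 0 + M e₁ 1) * Δ := by
    linear_combination (2 * (M e₀ 0 + M e₁ 1)) * hs
  rw [hs', real_inner_comm (A t e₀) (A' e₀), real_inner_comm (A t e₁) (A' e₁),
    real_inner_comm (A t e₁) (A' e₀)]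
  simp only [hexp]
  rw [real_inner_comm (A t e₀) (A t e₁)]
  simp only [Δ]
  push_cast
  ring

end GramDeterminant

/-! ### Regularity of the parameter domains at their boundary -/

section ChartDomain

theorem convex_halfPlane : Convex ℝ halfPlane := by
  intro x hx y hy a b ha hb _
  have hx' : 0 ≤ x 0 := hx
  have hy' : 0 ≤ y 0 := hy
  change 0 ≤ (a • x + b • y) 0
  simp only [PiLp.add_apply, PiLp.smul_apply, smul_eq_mul]
  positivity

theorem isClosed_halfPlane : IsClosed halfPlane :=
  isClosed_le continuous_const (by fun_prop)

theorem nonempty_interior_halfPlane : (interior halfPlane).Nonempty := by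
  refine ⟨EuclideanSpace.single 0 1, mem_interior.2 ⟨{y : E2 | 0 < y 0},
    fun y (hy : 0 < y 0) => hy.le, isOpen_lt continuous_const (by fun_prop), by simp⟩⟩

theorem _root_.Convex.subset_closure_interior {E : Type*} [NormedAddCommGroup E] [NormedSpace ℝ E]
    {s : Set E} (hs : Convex ℝ s) (h : (interior s).Nonempty) : s ⊆ closure (interior s) := by
  rw [hs.closure_interior_eq_closure_of_nonempty_interior h]
  exact subset_closure

theorem _root_.Set.OrdConnected.nonempty_interior {I : Set ℝ} (hI : I.OrdConnected)
    (hI' : I.Nontrivial) : (interior I).Nonempty :=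
  (hI.convex (𝕜 := ℝ)).nontrivial_iff_nonempty_interior.1 hI'

variable {I : Set ℝ} {V : Set E2}

theorem uniqueDiffOn_interval (hI : I.OrdConnected) (hI' : I.Nontrivial) : UniqueDiffOn ℝ I :=
  uniqueDiffOn_convex hI.convex (hI.nonempty_interior hI')

theorem uniqueDiffOn_chartDomain (hV : IsOpen V) : UniqueDiffOn ℝ (V ∩ halfPlane) := by
  rw [inter_comm]
  exact (uniqueDiffOn_convex convex_halfPlane nonempty_interior_halfPlane).inter hV

/-- Needed for symmetry of second derivatives at end points of `I` and on the edge of the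
half-plane. -/
theorem prod_subset_closure_interior (hI : I.OrdConnected) (hI' : I.Nontrivial) (hV : IsOpen V) :
    I ×ˢ (V ∩ halfPlane) ⊆ closure (interior (I ×ˢ (V ∩ halfPlane))) := by
  rw [interior_prod_eq, closure_prod_eq, interior_inter, hV.interior_eq]
  refine prod_mono (hI.convex.subset_closure_interior (hI.nonempty_interior hI')) ?_
  exact (inter_subset_inter_right _
    (convex_halfPlane.subset_closure_interior nonempty_interior_halfPlane)).trans hV.inter_closure

end ChartDomain

/-! ### The transport integrand in terms of the space-time derivative of `f` -/

section Integrand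

/-- The integrand `∂_t f + X · ∇f + f div_S X` of the surface transport theorem. -/
noncomputable def transportIntegrand (I : Set ℝ) (S : ℝ → Set E3) (X : ℝ → E3 → E3)
    (f : ℝ → E3 → ℝ) (t : ℝ) (x : E3) : ℝ :=
  derivWithin (fun s => f s x) I t + ⟪X t x, gradient (f t) x⟫ + f t x * surfaceDiv (S t) (X t) x

variable {I : Set ℝ} {f : ℝ → E3 → ℝ} {L : ℝ × E3 →L[ℝ] ℝ} {t : ℝ} {x : E3}

theorem derivWithin_eq_of_hasFDerivWithinAt (hI : UniqueDiffWithinAt ℝ I t)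
    (h : HasFDerivWithinAt (fun q : ℝ × E3 => f q.1 q.2) L (I ×ˢ univ) (t, x)) :
    derivWithin (fun s => f s x) I t = L (1, 0) :=
  (hasDerivWithinAt_slice h (mem_univ x)).derivWithin hI

theorem hasFDerivAt_of_hasFDerivWithinAt (ht : t ∈ I)
    (h : HasFDerivWithinAt (fun q : ℝ × E3 => f q.1 q.2) L (I ×ˢ univ) (t, x)) :
    HasFDerivAt (f t) (L.comp (ContinuousLinearMap.inr ℝ ℝ E3)) x := by
  rw [← hasFDerivWithinAt_univ]
  exact hasFDerivWithinAt_slice h ht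

theorem inner_gradient_eq (ht : t ∈ I)
    (h : HasFDerivWithinAt (fun q : ℝ × E3 => f q.1 q.2) L (I ×ˢ univ) (t, x)) (v : E3) :
    ⟪v, gradient (f t) x⟫ = L (0, v) := by
  rw [real_inner_comm, gradient, InnerProductSpace.toDual_symm_apply,
    (hasFDerivAt_of_hasFDerivWithinAt ht h).fderiv]
  rfl

theorem exists_hasFDerivWithinAt {N : Set (ℝ × E3)} (hN : IsOpen N)
    (hf : ContDiffOn ℝ 1 (fun q : ℝ × E3 => f q.1 q.2) (N ∩ I ×ˢ univ)) (ht : t ∈ I)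
    (hx : (t, x) ∈ N) :
    ∃ L : ℝ × E3 →L[ℝ] ℝ,
      HasFDerivWithinAt (fun q : ℝ × E3 => f q.1 q.2) L (I ×ˢ univ) (t, x) := by
  have h := (hf.differentiableOn one_ne_zero (t, x) ⟨hx, ht, mem_univ _⟩).hasFDerivWithinAt
  refine ⟨_, h.mono_of_mem_nhdsWithin ?_⟩
  exact inter_mem (mem_nhdsWithin_of_mem_nhds (hN.mem_nhds hx)) self_mem_nhdsWithin

end Integrand

/-! ### The transport theorem inside one moving chart -/

section LocalTransport

variable {I : Set ℝ} {S : ℝ → Set E3} {X : ℝ → E3 → E3} {f : ℝ → E3 → ℝ}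
  {V : Set E2} {G : ℝ × E2 → E3} {k : ℝ → E3 → E2}

/-- The derivative in the space variable of a family of parametrizations `G (t, ·)`. -/
noncomputable def spaceDeriv (I : Set ℝ) (D : Set E2) (G : ℝ × E2 → E3) (q : ℝ × E2) :
    E2 →L[ℝ] E3 :=
  (fderivWithin ℝ G (I ×ˢ D) q).comp (ContinuousLinearMap.inr ℝ ℝ E2)

/-- A smooth family `G (t, ·)`, with inverses `k t`, of parametrizations of relatively open pieces
of the surfaces `S t`, whose points move with velocity `X`. -/
structure IsMovingChart (I : Set ℝ) (S : ℝ → Set E3) (X : ℝ → E3 → E3) (V : Set E2)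
    (G : ℝ × E2 → E3) (k : ℝ → E3 → E2) : Prop where
  isOpen : IsOpen V
  contDiffOn : ContDiffOn ℝ 2 G (I ×ˢ (V ∩ halfPlane))
  param : ∀ t ∈ I, ∀ y ∈ V ∩ halfPlane, ∃ k' : E3 →L[ℝ] E2,
    IsParametrizationAt (S t) (V ∩ halfPlane) (fun z => G (t, z)) (k t)
      (spaceDeriv I (V ∩ halfPlane) G (t, y)) k' y
  velocity : ∀ t ∈ I, ∀ y ∈ V ∩ halfPlane,
    HasDerivWithinAt (fun s => G (s, y)) (X t (G (t, y))) I t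

namespace IsMovingChart

theorem uniqueDiffOn (h : IsMovingChart I S X V G k) (hI : I.OrdConnected) (hI' : I.Nontrivial) :
    UniqueDiffOn ℝ (I ×ˢ (V ∩ halfPlane)) :=
  (uniqueDiffOn_interval hI hI').prod (uniqueDiffOn_chartDomain h.isOpen)

theorem contDiffOn_fderivWithin (h : IsMovingChart I S X V G k) (hI : I.OrdConnected)
    (hI' : I.Nontrivial) :
    ContDiffOn ℝ 1 (fderivWithin ℝ G (I ×ˢ (V ∩ halfPlane))) (I ×ˢ (V ∩ halfPlane)) :=
  h.contDiffOn.fderivWithin (h.uniqueDiffOn hI hI') (by norm_num)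

theorem contDiffOn_spaceDeriv (h : IsMovingChart I S X V G k) (hI : I.OrdConnected)
    (hI' : I.Nontrivial) :
    ContDiffOn ℝ 1 (spaceDeriv I (V ∩ halfPlane) G) (I ×ˢ (V ∩ halfPlane)) :=
  (h.contDiffOn_fderivWithin hI hI').clm_comp contDiffOn_const

theorem injective (h : IsMovingChart I S X V G k) {t : ℝ} (ht : t ∈ I) {y : E2}
    (hy : y ∈ V ∩ halfPlane) : Function.Injective (spaceDeriv I (V ∩ halfPlane) G (t, y)) :=
  let ⟨_, h⟩ := h.param t ht y hy
  h.injective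

/-- The area element moves according to the divergence of the velocity along the surface. -/
theorem hasDerivWithinAt_normDet (h : IsMovingChart I S X V G k) (hI : I.OrdConnected)
    (hI' : I.Nontrivial) {t : ℝ} (ht : t ∈ I) {y : E2} (hy : y ∈ V ∩ halfPlane) :
    HasDerivWithinAt
      (fun s => (spaceDeriv I (V ∩ halfPlane) G (s, y) : E2 →ₗ[ℝ] E3).normDet)
      ((spaceDeriv I (V ∩ halfPlane) G (t, y) : E2 →ₗ[ℝ] E3).normDet *
        surfaceDiv (S t) (X t) (G (t, y))) I t := by
  set D := V ∩ halfPlane with hD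
  set Q := I ×ˢ D
  have hq : (t, y) ∈ Q := ⟨ht, hy⟩
  have hQ : UniqueDiffOn ℝ Q := h.uniqueDiffOn hI hI'
  set H := fderivWithin ℝ (fderivWithin ℝ G Q) Q (t, y)
  have hH : HasFDerivWithinAt (fderivWithin ℝ G Q) H Q (t, y) :=
    ((h.contDiffOn_fderivWithin hI hI').differentiableOn one_ne_zero _ hq).hasFDerivWithinAt
  have hsymm : ∀ v w, H v w = H w v :=
    (h.contDiffOn _ hq).isSymmSndFDerivWithinAt (by simp) hQ
      (prod_subset_closure_interior hI hI' h.isOpen hq) hq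
  -- Along the chart the velocity is `∂_t G`, which supplies the differentiability of `X t ∘ G` and
  -- expresses its derivative through the second derivative of `G`.
  have hvel : ∀ z ∈ D, X t (G (t, z)) = fderivWithin ℝ G Q (t, z) (1, 0) := fun z hz => by
    have h1 := hasDerivWithinAt_slice (h.contDiffOn.differentiableOn two_ne_zero (t, z)
      ⟨ht, hz⟩).hasFDerivWithinAt hz
    exact (uniqueDiffOn_interval hI hI' t ht).eq_deriv _ (h.velocity t ht z hz) h1
  obtain ⟨k', hk'⟩ := h.param t ht y hy
  have hw : HasFDerivWithinAt (fun z => X t (G (t, z)))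
      ((ContinuousLinearMap.apply ℝ E3 ((1 : ℝ), (0 : E2))).comp
        (H.comp (ContinuousLinearMap.inr ℝ ℝ E2))) D y := by
    refine HasFDerivWithinAt.congr ?_ hvel (hvel y hy)
    exact (ContinuousLinearMap.apply ℝ E3 ((1 : ℝ), (0 : E2))).hasFDerivAt.comp_hasFDerivWithinAt y
      (hasFDerivWithinAt_slice hH ht)
  obtain ⟨M, hM, hM'⟩ := hk'.exists_surfaceDiv_eq_trace (Y := X t) (fun z _ => rfl) hw
  rw [hM]
  refine SurfaceTransport.hasDerivWithinAt_normDet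
    (A' := (H (1, 0)).comp (ContinuousLinearMap.inr ℝ ℝ E2)) (fun v => ?_) (h.injective ht hy)
    fun u v => ?_
  · exact (ContinuousLinearMap.apply ℝ E3 ((0 : ℝ), v)).hasFDerivAt.comp_hasDerivWithinAt t
      (hasDerivWithinAt_slice hH hy)
  · rw [hM' u v]
    congr 1
    -- The time derivative of `d_y G` is the space derivative of the velocity.
    exact hsymm (0, v) (1, 0)

variable {N : Set (ℝ × E3)}

/-- The pull-back of the integrand to the parameter domain. -/
noncomputable def pullback (I : Set ℝ) (V : Set E2) (G : ℝ × E2 → E3) (f : ℝ → E3 → ℝ)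
    (q : ℝ × E2) : ℝ :=
  (spaceDeriv I (V ∩ halfPlane) G q : E2 →ₗ[ℝ] E3).normDet * f q.1 (G q)

theorem contDiffOn_pullback (h : IsMovingChart I S X V G k) (hI : I.OrdConnected)
    (hI' : I.Nontrivial) (hSN : ∀ t ∈ I, ∀ x ∈ S t, (t, x) ∈ N)
    (hf : ContDiffOn ℝ 1 (fun q : ℝ × E3 => f q.1 q.2) (N ∩ I ×ˢ univ)) :
    ContDiffOn ℝ 1 (pullback I V G f) (I ×ˢ (V ∩ halfPlane)) := by
  refine ContDiffOn.mul (fun q hq => ?_) ?_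
  · exact (contDiffAt_normDet (h.injective hq.1 hq.2)).comp_contDiffWithinAt q
      (h.contDiffOn_spaceDeriv hI hI' q hq)
  · refine hf.comp (contDiffOn_fst.prodMk (h.contDiffOn.of_le one_le_two)) fun q hq => ?_
    obtain ⟨k', hk'⟩ := h.param q.1 hq.1 q.2 hq.2
    exact ⟨hSN _ hq.1 _ (hk'.mapsTo hq.2), hq.1, mem_univ _⟩

theorem hasDerivWithinAt_pullback (h : IsMovingChart I S X V G k) (hI : I.OrdConnected)
    (hI' : I.Nontrivial) (hN : IsOpen N) (hSN : ∀ t ∈ I, ∀ x ∈ S t, (t, x) ∈ N)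
    (hf : ContDiffOn ℝ 1 (fun q : ℝ × E3 => f q.1 q.2) (N ∩ I ×ˢ univ))
    {t : ℝ} (ht : t ∈ I) {y : E2} (hy : y ∈ V ∩ halfPlane) :
    HasDerivWithinAt (fun s => pullback I V G f (s, y))
      ((spaceDeriv I (V ∩ halfPlane) G (t, y) : E2 →ₗ[ℝ] E3).normDet *
        transportIntegrand I S X f t (G (t, y))) I t := by
  obtain ⟨k', hk'⟩ := h.param t ht y hy
  obtain ⟨L, hL⟩ := exists_hasFDerivWithinAt hN hf ht (hSN t ht _ (hk'.mapsTo hy))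
  have h1 : HasDerivWithinAt (fun s => f s (G (s, y))) (L (1, X t (G (t, y)))) I t :=
    hL.comp_hasDerivWithinAt (f := fun s => (s, G (s, y))) t
      ((hasDerivWithinAt_id t I).prodMk (h.velocity t ht y hy)) fun s hs =>
        (⟨hs, mem_univ _⟩ : (s, G (s, y)) ∈ I ×ˢ univ)
  refine ((h.hasDerivWithinAt_normDet hI hI' ht hy).mul h1).congr_deriv ?_
  have h2 : L (1, X t (G (t, y))) = L (1, 0) + L (0, X t (G (t, y))) := by
    rw [← map_add]; simp
  rw [transportIntegrand, derivWithin_eq_of_hasFDerivWithinAt (uniqueDiffOn_interval hI hI' t ht)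
    hL,
    inner_gradient_eq ht hL, h2]
  ring

/-- The conclusion of the transport theorem for the moving set `R s`. -/
structure _root_.SurfaceTransport.IsTransported (I : Set ℝ) (S : ℝ → Set E3) (X : ℝ → E3 → E3)
    (f : ℝ → E3 → ℝ) (R : ℝ → Set E3) : Prop where
  measurableSet : ∀ t ∈ I, MeasurableSet (R t)
  integrableOn : ∀ t ∈ I, IntegrableOn (f t) (R t) μHE[2]
  integrableOn_integrand : ∀ t ∈ I, IntegrableOn (transportIntegrand I S X f t) (R t) μHE[2]
  hasDerivWithinAt : ∀ t ∈ I, HasDerivWithinAt (fun s => ∫ x in R s, f s x ∂μHE[2])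
    (∫ x in R t, transportIntegrand I S X f t x ∂μHE[2]) I t

theorem isTransported (h : IsMovingChart I S X V G k) (hI : I.OrdConnected)
    (hI' : I.Nontrivial) (hN : IsOpen N) (hSN : ∀ t ∈ I, ∀ x ∈ S t, (t, x) ∈ N)
    (hf : ContDiffOn ℝ 1 (fun q : ℝ × E3 => f q.1 q.2) (N ∩ I ×ˢ univ))
    {B C : Set E2} (hC : IsCompact C) (hCV : C ⊆ V ∩ halfPlane) (hBC : B ⊆ C)
    (hB : MeasurableSet B) :
    IsTransported I S X f fun t => (fun z => G (t, z)) '' B := by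
  set D := V ∩ halfPlane with hD
  have hBD : B ⊆ D := hBC.trans hCV
  have hPc := h.contDiffOn_pullback hI hI' hSN hf
  have hslice : ∀ t : ℝ, ContinuousOn (fun z : E2 => (t, z)) D := fun t => by fun_prop
  have hmap : ∀ t ∈ I, MapsTo (fun z : E2 => (t, z)) D (I ×ˢ D) := fun t ht z hz => ⟨ht, hz⟩
  have hg : ∀ t ∈ I, ∀ y ∈ D, HasFDerivWithinAt (fun z => G (t, z)) (spaceDeriv I D G (t, y)) D y :=
    fun t ht y hy => (h.param t ht y hy).choose_spec.deriv
  have hg' : ∀ t ∈ I, ContinuousOn (fun y => spaceDeriv I D G (t, y)) D := fun t ht =>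
    (h.contDiffOn_spaceDeriv hI hI').continuousOn.comp (hslice t) (hmap t ht)
  have hinj : ∀ t ∈ I, InjOn (fun z => G (t, z)) D := fun t ht y hy =>
    (h.param t ht y hy).choose_spec.leftInv.injOn hy
  have hinj' : ∀ t ∈ I, ∀ y ∈ D, Function.Injective (spaceDeriv I D G (t, y)) :=
    fun t ht y hy => h.injective ht hy
  have harea := fun t (ht : t ∈ I) => integral_image_eq_integral_normDet_smul (F := ℝ) h.isOpen
    convex_halfPlane hD (hg t ht) (hg' t ht) (hinj' t ht) (hinj t ht) hBD hB
  have hareai := fun t (ht : t ∈ I) => integrableOn_image_iff_integrableOn_normDet_smul (F := ℝ)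
    h.isOpen convex_halfPlane hD (hg t ht) (hg' t ht) (hinj' t ht) (hinj t ht) hBD hB
  simp only [finrank_euclideanSpace_fin, smul_eq_mul] at harea hareai
  -- Defined as the time derivative of the C¹ pull-back, `P'` is visibly continuous. Its
  -- identification with the area element times the transport integrand, by uniqueness of
  -- derivatives, then makes that integrand integrable.
  set P' : ℝ → E2 → ℝ := fun t y => fderivWithin ℝ (pullback I V G f) (I ×ˢ D) (t, y) (1, 0)
  have hP'c : ContinuousOn (fun q : ℝ × E2 => P' q.1 q.2) (I ×ˢ D) :=
    (hPc.continuousOn_fderivWithin (h.uniqueDiffOn hI hI') le_rfl).clm_apply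
      continuousOn_const
  have hP'd : ∀ t ∈ I, ∀ y ∈ D,
      HasDerivWithinAt (fun s => pullback I V G f (s, y)) (P' t y) I t := fun t ht y hy =>
    hasDerivWithinAt_slice
      (hPc.differentiableOn one_ne_zero (t, y) ⟨ht, hy⟩).hasFDerivWithinAt hy
  have hP'eq : ∀ t ∈ I, ∀ y ∈ D, P' t y = (spaceDeriv I D G (t, y) : E2 →ₗ[ℝ] E3).normDet *
      transportIntegrand I S X f t (G (t, y)) := fun t ht y hy =>
    (uniqueDiffOn_interval hI hI' t ht).eq_deriv _ (hP'd t ht y hy)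
      (h.hasDerivWithinAt_pullback hI hI' hN hSN hf ht hy)
  have hPt : ∀ t ∈ I, ContinuousOn (fun y => pullback I V G f (t, y)) C := fun t ht =>
    (hPc.continuousOn.comp (hslice t) (hmap t ht)).mono hCV
  have hP't : ∀ t ∈ I, ContinuousOn (P' t) C := fun t ht =>
    (hP'c.comp (hslice t) (hmap t ht)).mono hCV
  constructor
  · exact fun t ht => hB.image_of_continuousOn_injOn
      (fun y hy => ((hg t ht y (hBD hy)).mono hBD).continuousWithinAt) ((hinj t ht).mono hBD)
  · intro t ht
    rw [hareai t ht]
    exact ((hPt t ht).integrableOn_compact hC).mono_set hBC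
  · intro t ht
    rw [hareai t ht]
    refine IntegrableOn.congr_fun (((hP't t ht).integrableOn_compact hC).mono_set hBC)
      (fun y hy => ?_) hB
    exact hP'eq t ht y (hBD hy)
  · intro t ht
    rw [harea t ht, ← setIntegral_congr_fun hB fun y hy => hP'eq t ht y (hBD hy)]
    refine (hasDerivWithinAt_setIntegral_of_continuousOn volume hI hC hBC hB hPt
      (hP'c.mono (prod_mono_right hCV)) (fun s hs y hy => hP'd s hs y (hCV hy)) ht).congr
      (fun s hs => harea s hs _) (harea t ht _)

end IsMovingChart

end LocalTransport

/-! ### Additivity of the transport formula over disjoint moving sets -/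

section Patching

variable {I : Set ℝ} {S : ℝ → Set E3} {X : ℝ → E3 → E3} {f : ℝ → E3 → ℝ} {R R' : ℝ → Set E3}

theorem IsTransported.congr (h : IsTransported I S X f R) (hR : ∀ t ∈ I, R' t = R t) :
    IsTransported I S X f R' where
  measurableSet t ht := hR t ht ▸ h.measurableSet t ht
  integrableOn t ht := hR t ht ▸ h.integrableOn t ht
  integrableOn_integrand t ht := hR t ht ▸ h.integrableOn_integrand t ht
  hasDerivWithinAt t ht := by
    rw [hR t ht]
    exact (h.hasDerivWithinAt t ht).congr (fun s hs => by rw [hR s hs]) (by rw [hR t ht])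

theorem IsTransported.empty : IsTransported I S X f fun _ => ∅ where
  measurableSet _ _ := MeasurableSet.empty
  integrableOn _ _ := integrableOn_empty
  integrableOn_integrand _ _ := integrableOn_empty
  hasDerivWithinAt t _ := by simpa using hasDerivWithinAt_const t I (0 : ℝ)

theorem IsTransported.union (h : IsTransported I S X f R) (h' : IsTransported I S X f R')
    (hd : ∀ t ∈ I, Disjoint (R t) (R' t)) : IsTransported I S X f fun t => R t ∪ R' t where
  measurableSet t ht := (h.measurableSet t ht).union (h'.measurableSet t ht)
  integrableOn t ht := (h.integrableOn t ht).union (h'.integrableOn t ht)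
  integrableOn_integrand t ht := (h.integrableOn_integrand t ht).union
    (h'.integrableOn_integrand t ht)
  hasDerivWithinAt t ht := by
    have hu : ∀ s ∈ I, ∫ x in R s ∪ R' s, f s x ∂μHE[2] =
        ∫ x in R s, f s x ∂μHE[2] + ∫ x in R' s, f s x ∂μHE[2] := fun s hs =>
      setIntegral_union (hd s hs) (h'.measurableSet s hs) (h.integrableOn s hs)
        (h'.integrableOn s hs)
    rw [setIntegral_union (hd t ht) (h'.measurableSet t ht) (h.integrableOn_integrand t ht)
      (h'.integrableOn_integrand t ht)]
    exact ((h.hasDerivWithinAt t ht).add (h'.hasDerivWithinAt t ht)).congr hu (hu t ht)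

end Patching

/-! ### From charts of the reference surface to the whole material patch -/

section Flow

variable {I : Set ℝ} {S : ℝ → Set E3} {X : ℝ → E3 → E3} {t₀ : ℝ} {Φ Ψ : ℝ → E3 → E3}

/-- `Φ` is a flow map of the evolving surface `S` with velocity `X`, with inverse `Ψ`. -/
structure IsFlowMap (I : Set ℝ) (S : ℝ → Set E3) (X : ℝ → E3 → E3) (t₀ : ℝ)
    (Φ Ψ : ℝ → E3 → E3) : Prop where
  mem : t₀ ∈ I
  contDiffOn : ContDiffOn ℝ ∞ (fun q : ℝ × E3 => Φ q.1 q.2) (I ×ˢ S t₀)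
  apply_self : ∀ x ∈ S t₀, Φ t₀ x = x
  contDiffOn_inv : ∀ t ∈ I, ContDiffOn ℝ ∞ (Ψ t) (S t)
  mapsTo : ∀ t ∈ I, MapsTo (Φ t) (S t₀) (S t)
  mapsTo_inv : ∀ t ∈ I, MapsTo (Ψ t) (S t) (S t₀)
  leftInv : ∀ t ∈ I, LeftInvOn (Ψ t) (Φ t) (S t₀)
  rightInv : ∀ t ∈ I, RightInvOn (Ψ t) (Φ t) (S t)
  velocity : ∀ x ∈ S t₀, IsIntegralCurveOn (fun t => Φ t x) X I

theorem IsSmoothEvolvingSurface.exists_isFlowMap (hS : IsSmoothEvolvingSurface I S X) :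
    ∃ t₀ Φ Ψ, IsFlowMap I S X t₀ Φ Ψ := by
  obtain ⟨t₀, ht₀, Φ, Ψ, h1, h2, h3, h4⟩ := hS.flow
  exact ⟨t₀, Φ, Ψ, ht₀, h1, h2, fun t ht => (h3 t ht).1, fun t ht => (h3 t ht).2.1,
    fun t ht => (h3 t ht).2.2.1, fun t ht => (h3 t ht).2.2.2.1, fun t ht => (h3 t ht).2.2.2.2, h4⟩

namespace IsFlowMap

theorem isMovingChart (h : IsFlowMap I S X t₀ Φ Ψ)
    {U : Set E3} {V : Set E2} {φ : E2 → E3} {ψ : E3 → E2} (hU : IsOpen U) (hV : IsOpen V)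
    (hφ : ContDiffOn ℝ ∞ φ V) (hψ : ContDiffOn ℝ ∞ ψ U)
    (hφm : MapsTo φ (V ∩ halfPlane) (S t₀ ∩ U)) (hψm : MapsTo ψ (S t₀ ∩ U) (V ∩ halfPlane))
    (hl : LeftInvOn ψ φ (V ∩ halfPlane)) (hr : RightInvOn ψ φ (S t₀ ∩ U)) :
    IsMovingChart I S X V (fun q => Φ q.1 (φ q.2)) (fun t x => ψ (Ψ t x)) := by
  set D := V ∩ halfPlane with hD
  have h2 : (2 : ℕ∞ω) ≤ ∞ := WithTop.coe_le_coe.2 (le_top : (2 : ℕ∞) ≤ ⊤)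
  have hG : ContDiffOn ℝ 2 (fun q : ℝ × E2 => Φ q.1 (φ q.2)) (I ×ˢ D) := by
    refine (h.contDiffOn.of_le h2).comp (contDiffOn_fst.prodMk
      (((hφ.of_le h2).mono inter_subset_left).comp contDiffOn_snd
        fun q hq => hq.2)) fun q hq => ?_
    exact ⟨hq.1, (hφm hq.2).1⟩
  refine ⟨hV, hG, fun t ht y hy => ?_, fun t ht y hy => h.velocity _ (hφm hy).1 t ht⟩
  have hΨx : Ψ t (Φ t (φ y)) = φ y := h.leftInv t ht (hφm hy).1
  have hx : Φ t (φ y) ∈ S t := h.mapsTo t ht (hφm hy).1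
  have hΨd : DifferentiableWithinAt ℝ (Ψ t) (S t) (Φ t (φ y)) :=
    (h.contDiffOn_inv t ht).differentiableOn (by simp) _ hx
  have hψd : DifferentiableAt ℝ ψ (Ψ t (Φ t (φ y))) := by
    rw [hΨx]
    exact (hψ.differentiableOn (by simp)).differentiableAt (hU.mem_nhds (hφm hy).2)
  refine ⟨_, hy, uniqueDiffOn_chartDomain hV y hy, fun z hz => h.mapsTo t ht (hφm hz).1,
    fun z hz => ?_, ?_, hasFDerivWithinAt_slice
      (hG.differentiableOn two_ne_zero (t, y) ⟨ht, hy⟩).hasFDerivWithinAt ht,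
    hψd.hasFDerivAt.comp_hasFDerivWithinAt _ hΨd.hasFDerivWithinAt⟩
  · change ψ (Ψ t (Φ t (φ z))) = z
    rw [h.leftInv t ht (hφm hz).1, hl hz]
  -- Continuity of `Ψ t` brings points of `S t` near `Φ t (φ y)` back into the chart neighborhood
  -- `U`, where `φ` and `ψ` are inverse to each other.
  · have hev : ∀ᶠ z in 𝓝[S t] Φ t (φ y), Ψ t z ∈ U :=
      hΨd.continuousWithinAt.eventually (hU.mem_nhds (by rw [hΨx]; exact (hφm hy).2))
    filter_upwards [hev, self_mem_nhdsWithin] with z hz hzS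
    have hz' : Ψ t z ∈ S t₀ ∩ U := ⟨h.mapsTo_inv t ht hzS, hz⟩
    refine ⟨hψm hz', ?_⟩
    rw [hr hz', h.rightInv t ht hzS]

variable {N : Set (ℝ × E3)} {f : ℝ → E3 → ℝ}

/-- The neighborhood is the chart image of a compact half-ball. Allowing every Borel subset `E` of
it is what lets a patch be cut up along several charts. -/
theorem exists_nhdsWithin_isTransported (h : IsFlowMap I S X t₀ Φ Ψ) (hI : I.OrdConnected)
    (hI' : I.Nontrivial) (hS : IsSmoothSurface (S t₀)) (hN : IsOpen N)
    (hSN : ∀ t ∈ I, ∀ x ∈ S t, (t, x) ∈ N)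
    (hf : ContDiffOn ℝ 1 (fun q : ℝ × E3 => f q.1 q.2) (N ∩ I ×ˢ univ)) {p : E3}
    (hp : p ∈ S t₀) :
    ∃ s ∈ 𝓝[S t₀] p, MeasurableSet s ∧
      ∀ E ⊆ s, MeasurableSet E → IsTransported I S X f fun t => Φ t '' E := by
  obtain ⟨U, V, φ, ψ, hU, hpU, hV, hφ, hψ, hφm, hψm, hl, hr⟩ := hS p hp
  have hchart := h.isMovingChart hU hV hφ hψ hφm hψm hl hr
  obtain ⟨r, hr0, hrV⟩ := Metric.nhds_basis_closedBall.mem_iff.1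
    (hV.mem_nhds (hψm ⟨hp, hpU⟩).1)
  set C := Metric.closedBall (ψ p) r ∩ halfPlane with hCdef
  have hC : IsCompact C := (isCompact_closedBall _ _).inter_right isClosed_halfPlane
  have hCV : C ⊆ V ∩ halfPlane := inter_subset_inter_left _ hrV
  refine ⟨φ '' C, ?_, ?_, fun E hE hEm => ?_⟩
  · have h1 : ∀ᶠ x in 𝓝 p, ψ x ∈ Metric.closedBall (ψ p) r :=
      (hψ.continuousOn.continuousAt (hU.mem_nhds hpU)).eventually
        (Metric.closedBall_mem_nhds _ hr0)
    filter_upwards [mem_nhdsWithin_of_mem_nhds h1, mem_nhdsWithin_of_mem_nhds (hU.mem_nhds hpU),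
      self_mem_nhdsWithin] with x hx1 hx2 hx3
    exact ⟨ψ x, ⟨hx1, (hψm ⟨hx3, hx2⟩).2⟩, hr ⟨hx3, hx2⟩⟩
  · exact (hC.image_of_continuousOn
      (hφ.continuousOn.mono (hCV.trans inter_subset_left))).measurableSet
  · have hES : E ⊆ S t₀ ∩ U := hE.trans (image_subset_iff.2 fun y hy => hφm (hCV hy))
    have hB : MeasurableSet (ψ '' E) := hEm.image_of_continuousOn_injOn
      (hψ.continuousOn.mono (hES.trans inter_subset_right)) (hr.injOn.mono hES)
    have hBC : ψ '' E ⊆ C := by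
      rintro _ ⟨x, hx, rfl⟩
      obtain ⟨y, hy, rfl⟩ := hE hx
      rwa [hl (hCV hy)]
    refine (hchart.isTransported hI hI' hN hSN hf hC hCV hBC hB).congr fun t _ => ?_
    rw [image_image]
    exact image_congr fun x hx => by rw [hr (hES hx)]

theorem isTransported_image (h : IsFlowMap I S X t₀ Φ Ψ) (hI : I.OrdConnected)
    (hI' : I.Nontrivial) (hS : IsSmoothSurface (S t₀)) (hN : IsOpen N)
    (hSN : ∀ t ∈ I, ∀ x ∈ S t, (t, x) ∈ N)
    (hf : ContDiffOn ℝ 1 (fun q : ℝ × E3 => f q.1 q.2) (N ∩ I ×ˢ univ)) {K E : Set E3}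
    (hK : IsCompact K) (hKS : K ⊆ S t₀) (hEK : E ⊆ K) (hE : MeasurableSet E) :
    IsTransported I S X f fun t => Φ t '' E := by
  -- Compact induction carries a Borel set `s` containing `K`, because the union step splits `E`
  -- into `E ∩ s` and `E \ s`. Restricting to `S t₀` keeps `Φ t` injective, so the moving pieces
  -- stay disjoint.
  obtain ⟨s, hsm, hKs, hs⟩ : ∃ s, MeasurableSet s ∧ K ⊆ s ∧
      ∀ E ⊆ s ∩ S t₀, MeasurableSet E → IsTransported I S X f fun t => Φ t '' E := by
    refine hK.induction_on (p := fun K => ∃ s, MeasurableSet s ∧ K ⊆ s ∧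
      ∀ E ⊆ s ∩ S t₀, MeasurableSet E → IsTransported I S X f fun t => Φ t '' E) ?_ ?_ ?_ ?_
    · refine ⟨∅, MeasurableSet.empty, subset_rfl, fun E hE _ => ?_⟩
      rw [empty_inter, subset_empty_iff] at hE
      subst hE
      simpa using IsTransported.empty
    · rintro K K' hKK' ⟨s, hsm, hs, hsE⟩
      exact ⟨s, hsm, hKK'.trans hs, hsE⟩
    · rintro K K' ⟨s, hsm, hs, hsE⟩ ⟨s', hsm', hs', hsE'⟩
      refine ⟨s ∪ s', hsm.union hsm', union_subset_union hs hs', fun E hE hEm => ?_⟩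
      have h1 := hsE (E ∩ s) (fun x hx => ⟨hx.2, (hE hx.1).2⟩) (hEm.inter hsm)
      have h2 := hsE' (E \ s) (fun x hx => ⟨(hE hx.1).1.resolve_left hx.2, (hE hx.1).2⟩)
        (hEm.diff hsm)
      refine (h1.union h2 fun t ht => ?_).congr fun t _ => ?_
      · have hinj : InjOn (Φ t) (S t₀) := (h.leftInv t ht).injOn
        rw [disjoint_left]
        rintro _ ⟨x, hx, rfl⟩ ⟨z, hz, hzx⟩
        rw [hinj (hE hz.1).2 (hE hx.1).2 hzx] at hz
        exact hz.2 hx.2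
      · rw [← image_union, inter_union_sdiff]
    · intro p hp
      obtain ⟨s, hsp, hsm, hs⟩ := h.exists_nhdsWithin_isTransported hI hI' hS hN hSN hf (hKS hp)
      exact ⟨s, nhdsWithin_mono p hKS hsp, s, hsm, subset_rfl,
        fun E hE => hs E (hE.trans inter_subset_left)⟩
  exact hs E (fun x hx => ⟨hKs (hEK hx), hKS (hEK hx)⟩) hE

/-- Flow lines are trajectories on the surface, so the material property can be followed from `t₀`
to `t` and, through `Ψ t`, back to `t₀`, where the flow is the identity. -/
theorem image_eq_of_isMaterialPatch (h : IsFlowMap I S X t₀ Φ Ψ) {A : ℝ → Set E3}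
    (hA : IsMaterialPatch I S X A) {t : ℝ} (ht : t ∈ I) : A t = Φ t '' A t₀ := by
  have hAS : ∀ s ∈ I, A s ⊆ S s := fun s hs =>
    let ⟨_, _, h1, h2⟩ := hA.relCompact s hs
    h1.trans h2
  ext x
  constructor
  · intro hx
    have hy := h.mapsTo_inv t ht (hAS t ht hx)
    have hyx : Φ t (Ψ t x) = x := h.rightInv t ht (hAS t ht hx)
    refine ⟨Ψ t x, ?_, hyx⟩
    have := hA.material (fun s => Φ s (Ψ t x)) (fun s hs => h.mapsTo s hs hy) (h.velocity _ hy)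
      t ht t₀ h.mem (by rwa [hyx])
    rwa [h.apply_self _ hy] at this
  · rintro ⟨y, hy, rfl⟩
    have hyS := hAS t₀ h.mem hy
    exact hA.material (fun s => Φ s y) (fun s hs => h.mapsTo s hs hyS) (h.velocity _ hyS)
      t₀ h.mem t ht (by rwa [h.apply_self _ hyS])

theorem finrank_tangentSpace_eq_two (h : IsFlowMap I S X t₀ Φ Ψ)
    (hS : IsSmoothSurface (S t₀)) {t : ℝ} (ht : t ∈ I) {x : E3}
    (hx : x ∈ S t) : Module.finrank ℝ (tangentSpace (S t) x) = 2 := by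
  have hp := h.mapsTo_inv t ht hx
  obtain ⟨U, V, φ, ψ, hU, hpU, hV, hφ, hψ, hφm, hψm, hl, hr⟩ := hS _ hp
  obtain ⟨k', hk'⟩ := (h.isMovingChart hU hV hφ hψ hφm hψm hl hr).param t ht
    (ψ (Ψ t x)) (hψm ⟨hp, hpU⟩)
  have := hk'.finrank_tangentSpace
  simp only at this
  rwa [hr ⟨hp, hpU⟩, h.rightInv t ht hx, finrank_euclideanSpace_fin] at this

end IsFlowMap

end Flow

end SurfaceTransport

/-! ### The transport theorem and its insoluble case -/

theorem mainTheorem4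
    (I : Set ℝ) (hI : I.OrdConnected) (hI' : I.Nontrivial)
    (S : ℝ → Set SurfaceTransport.E3) (X : ℝ → SurfaceTransport.E3 → SurfaceTransport.E3)
    (hS : SurfaceTransport.IsSmoothEvolvingSurface I S X)
    (A : ℝ → Set SurfaceTransport.E3) (hA : SurfaceTransport.IsMaterialPatch I S X A)
    (N : Set (ℝ × SurfaceTransport.E3)) (hN : IsOpen N)
    (hSN : ∀ t ∈ I, ∀ x ∈ S t, (t, x) ∈ N)
    (f : ℝ → SurfaceTransport.E3 → ℝ)
    (hf : ContDiffOn ℝ 1 (fun q : ℝ × SurfaceTransport.E3 => f q.1 q.2) (N ∩ I ×ˢ univ)) :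
    (∀ t ∈ I, IntegrableOn (f t) (A t) μHE[2]) ∧
    (∀ t ∈ I,
      IntegrableOn (fun x => derivWithin (fun s => f s x) I t + ⟪X t x, gradient (f t) x⟫
        + f t x * SurfaceTransport.surfaceDiv (S t) (X t) x) (A t) μHE[2] ∧
      HasDerivWithinAt (fun s => ∫ x in A s, f s x ∂μHE[2])
        (∫ x in A t, (derivWithin (fun s => f s x) I t + ⟪X t x, gradient (f t) x⟫
          + f t x * SurfaceTransport.surfaceDiv (S t) (X t) x) ∂μHE[2]) I t) ∧
    (∀ n : ℝ → SurfaceTransport.E3 → SurfaceTransport.E3,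
      (∀ t ∈ I, ∀ x ∈ S t, SurfaceTransport.IsUnitNormal (S t) x (n t x)) →
      (∀ t ∈ I, ∀ x ∈ S t, ⟪n t x, gradient (f t) x⟫ = 0) →
      ∀ t ∈ I,
        IntegrableOn (fun x => derivWithin (fun s => f s x) I t
          + ⟪X t x, SurfaceTransport.surfaceGrad (S t) (f t) x⟫
          + f t x * SurfaceTransport.surfaceDiv (S t) (X t) x) (A t) μHE[2] ∧
        HasDerivWithinAt (fun s => ∫ x in A s, f s x ∂μHE[2])
          (∫ x in A t, (derivWithin (fun s => f s x) I t
            + ⟪X t x, SurfaceTransport.surfaceGrad (S t) (f t) x⟫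
            + f t x * SurfaceTransport.surfaceDiv (S t) (X t) x) ∂μHE[2]) I t) := by
  obtain ⟨t₀, Φ, Ψ, hΦ⟩ := hS.exists_isFlowMap
  have hS₀ := hS.smooth t₀ hΦ.mem
  obtain ⟨K, hK, hAK, hKS⟩ := hA.relCompact t₀ hΦ.mem
  have hT : SurfaceTransport.IsTransported I S X f A :=
    (hΦ.isTransported_image hI hI' hS₀ hN hSN hf hK hKS hAK (hA.measurable t₀ hΦ.mem)).congr
      fun t ht => hΦ.image_eq_of_isMaterialPatch hA ht
  refine ⟨hT.integrableOn, fun t ht => ⟨hT.integrableOn_integrand t ht, hT.hasDerivWithinAt t ht⟩,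
    fun n hn hnf t ht => ?_⟩
  have hcongr : EqOn (SurfaceTransport.transportIntegrand I S X f t)
      (fun x => derivWithin (fun s => f s x) I t
        + ⟪X t x, SurfaceTransport.surfaceGrad (S t) (f t) x⟫
        + f t x * SurfaceTransport.surfaceDiv (S t) (X t) x) (A t) := by
    intro x hx
    obtain ⟨K', _, hAK', hKS'⟩ := hA.relCompact t ht
    have hxS := hKS' (hAK' hx)
    obtain ⟨L, hL⟩ := SurfaceTransport.exists_hasFDerivWithinAt hN hf ht (hSN t ht x hxS)
    have hgrad := SurfaceTransport.surfaceGrad_eq_gradient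
      (SurfaceTransport.hasFDerivAt_of_hasFDerivWithinAt ht hL).differentiableAt
      (hΦ.finrank_tangentSpace_eq_two hS₀ ht hxS) (hn t ht x hxS) (hnf t ht x hxS)
    simp only [SurfaceTransport.transportIntegrand, hgrad]
  refine ⟨(hT.integrableOn_integrand t ht).congr_fun hcongr (hA.measurable t ht), ?_⟩
  rw [← setIntegral_congr_fun (hA.measurable t ht) hcongr]
  exact hT.hasDerivWithinAt t ht
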